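/- For integers $k,N\ge 0$ let $T_{\pm 3^k(3^{k+1})}(N)$ be the number of partition triples of $N$ (ordered triples of partitions whose sizes add up to $N$) in which no part of any of the three partitions is congruent to $3^k$ or $-3^k$ modulo $3^{k+1}$; equivalently, $$\sum_{N\ge 0}T_{\pm 3^k(3^{k+1})}(N)\,q^N=\frac{E(q^{3^k})^3}{E(q)^3\,E(q^{3^{k+1}})^3},\qquad E(q)=\prod_{m\ge1}(1-q^m).$$ Let $\alpha,\beta,n\ge 0$ be integers and write $T=T_{\pm 3^{2\alpha+1}(3^{2\alpha+2})}$. Then: (1) $\displaystyle T\!\left(3^{2\alpha+2\beta+1}n+\frac{3^{2\alpha+2\beta+2}+2\cdot 3^{2\alpha+1}+1}{8}\right)\equiv 0 \pmod{3^{3\alpha+\beta+2}};$ (2) $\displaystyle T\!\left(3^{2\alpha+2\beta+2}n+\frac{11\cdot 3^{2\alpha+2\beta+1}+2\cdot 3^{2\alpha+1}+1}{8}\right)\equiv 0 \pmod{3^{3\alpha+\beta+4}};$ (3) $\displaystyle T\!\left(3^{2\alpha+2\beta+2}n+\frac{19\cdot 3^{2\alpha+2\beta+1}+2\cdot 3^{2\alpha+1}+1}{8}\right)\equiv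 0 \pmod{3^{3\alpha+\beta+5}};$ (4) modulo $3^{3\alpha+\beta+4}$, $$T\!\left(3^{2\alpha+2\beta+2}n+\frac{3^{2\alpha+2\beta+2}+2\cdot 3^{2\alpha+1}+1}{8}\right)\equiv\begin{cases}2^{\beta}\,5^{\alpha}\,3^{3\alpha+\beta+2}\,(-1)^j(2j+1)&\text{if } n=j(j+1)/2 \text{ for an integer } j\ge 0,\\ 0&\text{if } n \text{ is not of this form};\end{cases}$$ (5) for every odd prime $p$ with $p\nmid n$ and every integer $k\ge 0$, $$T\!\left(3^{2\alpha+2\beta+2}p^{2k+1}n+\frac{p^{2k+2}\,3^{2\alpha+2\beta+2}+2\cdot 3^{2\alpha+1}+1}{8}\right)\equiv 0 \pmod{3^{3\alpha+\beta+4}}.$$ -/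

import Mathlib

/-- `i` is not congruent to `3 ^ k` or to `-3 ^ k` modulo `3 ^ (k + 1)`. -/
def AllowedPart (k i : ℕ) : Prop :=
  ¬ ((i : ℤ) ≡ 3 ^ k [ZMOD 3 ^ (k + 1)] ∨ (i : ℤ) ≡ -3 ^ k [ZMOD 3 ^ (k + 1)])

instance (k : ℕ) : DecidablePred (AllowedPart k) := fun i => by
  unfold AllowedPart; infer_instance

/-- The partition triples of `n` without parts congruent to `± 3 ^ k` modulo `3 ^ (k + 1)`:
a triple of sizes `x 0 + x 1 + x 2 = n`, together with a partition of each `x i` all of whose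
parts are allowed. -/
def pmTriples (k n : ℕ) : Finset (Σ x : Fin 3 → ℕ, ∀ i : Fin 3, (x i).Partition) :=
  (Finset.Nat.antidiagonalTuple 3 n).sigma fun x =>
    Fintype.piFinset fun i => Nat.Partition.restricted (x i) (AllowedPart k)

/-- The number of partition triples of `n` without parts congruent to `± 3 ^ k` modulo
`3 ^ (k + 1)`. -/
def pmT (k n : ℕ) : ℕ := (pmTriples k n).card

/-! Write E for `euler`, k = 2α+1. The generating function is E(q)⁻³ times E³/E(q³)³ taken at
q^(3^k). Trisection commutes with multiplication by series in q³, so the progressions are reached by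
2α+1 trisections of E⁻³, multiplication by E³/E(q³)³, and 2β further trisections.

All resulting series are an eta quotient times a polynomial in the Hauptmodul h = q E(q³)¹²/E¹². Put
w = q E(q⁹)³/E³. Jacobi's series for E³ dissects modulo 3, and its norm over the cube roots of unity
yields w³ = h(q³)(1+9w+27w²); also h·h(q³) = w⁴. The first relation gives a recursion for the
trisection of wⁱ as a polynomial in h (`sect_cubeQuot_pow`), whose coefficient of hʲ is divisible by
3^(3j-i) (`pow_dvd_coeff_sectPoly`). The second reduces every trisection needed to such powers of w.

Hence polynomials with j-th coefficient divisible by 3^(e+3j) are preserved (`exists_sect_hasLead`),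
e starting at 2 and growing by 3 per α-round and by 1 per β-round. Their constant coefficients are
known modulo 3^(e+2): they start at 9 and are multiplied by 90·15 ≡ 5·27 (mod 243) and by 6. This
gives (1). For the other parts only the constant coefficient matters: (2) and (3) follow from
dissecting E³h/E(q³)⁶, (4) from E(q³)³/E⁶ ≡ E³ (mod 9) and Jacobi's identity, and (5) because the
relevant 8m+1 is not a square. -/

open PowerSeries Finset

/-! ### Gaussian binomials and a finite Jacobi identity. -/

/-- The finite `q`-Pochhammer symbol `(1 - q) (1 - q ^ 2) ⋯ (1 - q ^ n)`. -/
def qPoch {R : Type*} [CommRing R] (q : R) (n : ℕ) : R := ∏ k ∈ range n, (1 - q ^ (k + 1))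

/-- The Gaussian binomial coefficient. -/
def qBinom {R : Type*} [CommRing R] (q : R) : ℕ → ℕ → R
  | _, 0 => 1
  | 0, _ + 1 => 0
  | m + 1, i + 1 => q ^ (i + 1) * qBinom q m (i + 1) + qBinom q m i

section qBinom
variable {R S : Type*} [CommRing R] [CommRing S]

@[simp] theorem qPoch_zero (q : R) : qPoch q 0 = 1 := by simp [qPoch]

theorem qPoch_succ (q : R) (n : ℕ) : qPoch q (n + 1) = qPoch q n * (1 - q ^ (n + 1)) := by
  simp [qPoch, prod_range_succ]

theorem qPoch_map (f : R →+* S) (q : R) (n : ℕ) : f (qPoch q n) = qPoch (f q) n := by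
  simp [qPoch]

@[simp] theorem qBinom_zero_right (q : R) (m : ℕ) : qBinom q m 0 = 1 := by
  cases m <;> simp [qBinom]

theorem qBinom_map (f : R →+* S) (q : R) (m i : ℕ) :
    f (qBinom q m i) = qBinom (f q) m i := by
  induction m generalizing i with
  | zero => cases i <;> simp [qBinom]
  | succ m ih => cases i <;> simp [qBinom, ih]

theorem qBinom_eq_zero (q : R) {m i : ℕ} (h : m < i) : qBinom q m i = 0 := by
  induction m generalizing i with
  | zero => obtain _ | i := i <;> simp_all [qBinom]
  | succ m ih =>
    obtain _ | i := i
    · omega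
    · simp [qBinom, ih (show m < i by omega), ih (show m < i + 1 by omega)]

theorem qBinom_self (q : R) (m : ℕ) : qBinom q m m = 1 := by
  induction m with
  | zero => simp
  | succ m ih => simp [qBinom, ih, qBinom_eq_zero q (show m < m + 1 by omega)]

theorem qBinom_mul_qPoch (q : R) (a b : ℕ) :
    qBinom q (a + b) a * qPoch q a * qPoch q b = qPoch q (a + b) := by
  induction hn : a + b generalizing a b with
  | zero =>
    obtain ⟨rfl, rfl⟩ : a = 0 ∧ b = 0 := by omega
    simp
  | succ n ih =>
    obtain _ | a := a
    · obtain rfl : b = n + 1 := by omega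
      simp
    · obtain _ | b := b
      · obtain rfl : a = n := by omega
        simp [qBinom_self]
      · have h1 := ih (a + 1) b (by omega)
        have h2 := ih a (b + 1) (by omega)
        simp only [qPoch_succ, qBinom] at *
        obtain rfl : n = a + b + 1 := by omega
        have e : q ^ (a + b + 1 + 1) = q ^ (a + 1) * q ^ (b + 1) := by ring
        rw [e, ← sub_eq_zero]
        linear_combination q ^ (a + 1) * (1 - q ^ (b + 1)) * h1 + (1 - q ^ (a + 1)) * h2

/-- The `q`-binomial theorem. -/
theorem prod_add_mul_pow (q x z : R) (m : ℕ) :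
    ∏ k ∈ range m, (x + z * q ^ k) =
      ∑ i ∈ range (m + 1), q ^ (i.choose 2) * qBinom q m i * z ^ i * x ^ (m - i) := by
  induction m generalizing z with
  | zero => simp
  | succ m ih =>
    have h : ∀ k, x + z * q ^ (k + 1) = x + (z * q) * q ^ k := fun k => by ring
    rw [prod_range_succ', pow_zero, mul_one]
    simp only [h]
    rw [ih, sum_range_succ' _ (m + 1), mul_add]
    simp only [qBinom, mul_add, add_mul, sum_add_distrib]
    have h1 : (∑ i ∈ range (m + 1), q ^ (i.choose 2) * qBinom q m i * (z * q) ^ i * x ^ (m - i)) * x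
        = ∑ i ∈ range (m + 1), q ^ ((i + 1).choose 2) * (q ^ (i + 1) * qBinom q m (i + 1))
            * z ^ (i + 1) * x ^ (m + 1 - (i + 1)) + x ^ (m + 1) := by
      rw [sum_range_succ' _ m, sum_range_succ _ m, qBinom_eq_zero q (show m < m + 1 by omega)]
      simp only [add_mul, sum_mul]
      have e : ∑ i ∈ range m, q ^ ((i + 1).choose 2) * qBinom q m (i + 1) * (z * q) ^ (i + 1)
            * x ^ (m - (i + 1)) * x
          = ∑ i ∈ range m, q ^ ((i + 1).choose 2) * (q ^ (i + 1) * qBinom q m (i + 1))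
            * z ^ (i + 1) * x ^ (m + 1 - (i + 1)) := by
        refine sum_congr rfl fun i hi => ?_
        rw [mem_range] at hi
        rw [show m + 1 - (i + 1) = m - (i + 1) + 1 by omega]
        ring
      rw [e]
      simp [pow_succ]
    have h2 : (∑ i ∈ range (m + 1), q ^ (i.choose 2) * qBinom q m i * (z * q) ^ i * x ^ (m - i)) * z
        = ∑ i ∈ range (m + 1), q ^ ((i + 1).choose 2) * qBinom q m i
            * z ^ (i + 1) * x ^ (m + 1 - (i + 1)) := by
      rw [sum_mul]
      refine sum_congr rfl fun i hi => ?_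
      rw [Nat.choose_succ_succ' i 1, Nat.choose_one_right, Nat.add_sub_add_right]
      ring
    rw [h1, h2]
    simp
    ring

/-- The derivative at `z = 1` of the `q`-binomial theorem centred at the root `z = 1`. -/
theorem qPoch_sq_mul_pow (q : R) (n : ℕ) :
    (-1) ^ n * q ^ (n.choose 2 + n + n ^ 2) * qPoch q n ^ 2 =
      ∑ i ∈ range (2 * n + 2),
        q ^ (i.choose 2) * qBinom q (2 * n + 1) i * (-q ^ n) ^ (2 * n + 1 - i) * i := by
  have key := congrArg (fun p : Polynomial R => p.derivative.eval 1)
    (prod_add_mul_pow (Polynomial.C q) (Polynomial.C (-q ^ n)) Polynomial.X (2 * n + 1))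
  simp only [← qBinom_map, Polynomial.derivative_sum, Polynomial.eval_finsetSum] at key
  -- The factor with k = n is q ^ n * (z - 1), so the derivative at z = 1 is q ^ n times the values
  -- there of the products over k < n and k > n.
  rw [show 2 * n + 1 = n + (1 + n) by ring, prod_range_add, prod_range_add] at key
  have hroot : Polynomial.C (-q ^ n) + Polynomial.X * Polynomial.C q ^ (n + 0)
      = Polynomial.C (q ^ n) * (Polynomial.X - 1) := by
    simp only [map_neg, map_pow, add_zero]; ring
  simp only [prod_range_one, hroot] at key
  set A := ∏ k ∈ range n, (Polynomial.C (-q ^ n) + Polynomial.X * Polynomial.C q ^ k) with hA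
  set B := ∏ k ∈ range n,
    (Polynomial.C (-q ^ n) + Polynomial.X * Polynomial.C q ^ (n + (1 + k))) with hB
  have hAe : A.eval 1 = q ^ (n.choose 2) * qPoch q n := by
    have e : ∀ k ∈ range n, (Polynomial.C (-q ^ n) + Polynomial.X * Polynomial.C q ^ k).eval 1
        = q ^ k * (1 - q ^ (n - 1 - k + 1)) := by
      intro k hk
      rw [mem_range] at hk
      have : q ^ n = q ^ k * q ^ (n - 1 - k + 1) := by rw [← pow_add]; congr 1; omega
      simp [this]
      ring
    rw [hA, Polynomial.eval_prod, prod_congr rfl e, prod_mul_distrib,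
      prod_range_reflect (fun k => 1 - q ^ (k + 1)) n, prod_pow_eq_pow_sum, sum_range_id,
      Nat.choose_two_right, qPoch]
  have hBe : B.eval 1 = (-1) ^ n * q ^ (n ^ 2) * qPoch q n := by
    have e : ∀ k ∈ range n,
        (Polynomial.C (-q ^ n) + Polynomial.X * Polynomial.C q ^ (n + (1 + k))).eval 1
        = -q ^ n * (1 - q ^ (k + 1)) := by
      intro k _
      simp
      ring
    rw [hB, Polynomial.eval_prod, prod_congr rfl e, prod_mul_distrib, prod_const, card_range, qPoch,
      neg_pow, ← pow_mul, sq]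
  have hl : (Polynomial.derivative (A * (Polynomial.C (q ^ n) * (Polynomial.X - 1) * B))).eval 1
      = (-1) ^ n * q ^ (n.choose 2 + n + n ^ 2) * qPoch q n ^ 2 := by
    simp [Polynomial.derivative_mul, hAe, hBe]
    ring
  rw [← hl, key, show n + (1 + n) + 1 = 2 * n + 2 by ring]
  refine sum_congr rfl fun i _ => ?_
  rw [show n + (1 + n) - i = 2 * n + 1 - i by omega]
  have : Polynomial.C q ^ i.choose 2 * Polynomial.C (qBinom q (n + (1 + n)) i) * Polynomial.X ^ i
      * Polynomial.C (-q ^ n) ^ (2 * n + 1 - i)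
      = Polynomial.C (q ^ i.choose 2 * qBinom q (n + (1 + n)) i * (-q ^ n) ^ (2 * n + 1 - i))
        * Polynomial.X ^ i := by
    simp only [map_mul, map_pow]; ring
  rw [this, Polynomial.derivative_C_mul, Polynomial.derivative_X_pow,
    show 2 * n + 1 = n + (1 + n) by ring]
  simp

theorem qBinom_symm [IsDomain R] (q : R) (hq : ∀ n, qPoch q n ≠ 0) (a b : ℕ) :
    qBinom q (a + b) a = qBinom q (a + b) b := by
  have h1 := qBinom_mul_qPoch q a b
  have h2 := qBinom_mul_qPoch q b a
  rw [add_comm b a] at h2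
  apply mul_right_cancel₀ (mul_ne_zero (hq a) (hq b))
  linear_combination h1 - h2

theorem triangle_succ (j : ℕ) : (j + 1) * (j + 1 + 1) / 2 = j * (j + 1) / 2 + (j + 1) := by
  rw [show (j + 1) * (j + 1 + 1) = j * (j + 1) + (j + 1) * 2 by ring,
    Nat.add_mul_div_right _ _ two_pos]

theorem two_mul_triangle (j : ℕ) : 2 * (j * (j + 1) / 2) = j * (j + 1) :=
  Nat.mul_div_cancel' (Nat.even_mul_succ_self j).two_dvd

theorem two_mul_choose_two (j : ℕ) : (2 * (j.choose 2) : ℤ) = j * (j - 1) := by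
  obtain _ | j := j
  · simp
  · have := two_mul_triangle j
    rw [Nat.choose_two_right, Nat.add_sub_cancel, mul_comm (j + 1) j]
    push_cast
    zify at this
    rw [this]; ring

/-- A finite form of Jacobi's identity for the cube of the Euler product. -/
theorem qPoch_sq [IsDomain R] (q : R) (h0 : q ≠ 0) (hq : ∀ n, qPoch q n ≠ 0) (n : ℕ) :
    qPoch q n ^ 2 = ∑ j ∈ range (n + 1),
      (-1) ^ j * (2 * j + 1) * q ^ (j * (j + 1) / 2) * qBinom q (2 * n + 1) (n - j) := by
  apply mul_left_cancel₀ (mul_ne_zero (pow_ne_zero n (neg_ne_zero.mpr (one_ne_zero (α := R))))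
    (pow_ne_zero (n.choose 2 + n + n ^ 2) h0))
  -- The indices n - j and n + 1 + j are paired: binomials and powers of q agree, and the weights
  -- enter with opposite signs, leaving 2 * j + 1.
  rw [qPoch_sq_mul_pow, show 2 * n + 2 = (n + 1) + (n + 1) by ring, sum_range_add,
    ← sum_range_reflect, ← sum_add_distrib, mul_sum]
  refine sum_congr rfl fun j hj => ?_
  obtain ⟨d, rfl⟩ : ∃ d, n = j + d := ⟨n - j, by rw [mem_range] at hj; omega⟩
  have hs := qBinom_symm q hq d (2 * j + d + 1)
  rw [show d + (2 * j + d + 1) = 2 * (j + d) + 1 by ring] at hs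
  have e1 : j + d + 1 - 1 - j = d := by omega
  have e2 : 2 * (j + d) + 1 - d = 2 * j + d + 1 := by omega
  have e3 : 2 * (j + d) + 1 - (j + d + 1 + j) = d := by omega
  have e4 : j + d - j = d := by omega
  have e5 : j + d + 1 + j = 2 * j + d + 1 := by ring
  rw [e1, e2, e3, e4, e5, ← hs, neg_pow, neg_pow (q ^ (j + d)) d, ← pow_mul, ← pow_mul]
  have p1 : d.choose 2 + (j + d) * (2 * j + d + 1)
      = (j + d).choose 2 + (j + d) + (j + d) ^ 2 + j * (j + 1) / 2 := by
    have a1 := two_mul_choose_two d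
    have a2 := two_mul_choose_two (j + d)
    have a3 := two_mul_triangle j
    zify at *
    linarith
  have p2 : (2 * j + d + 1).choose 2 + (j + d) * d
      = (j + d).choose 2 + (j + d) + (j + d) ^ 2 + j * (j + 1) / 2 := by
    have a1 := two_mul_choose_two (2 * j + d + 1)
    have a2 := two_mul_choose_two (j + d)
    have a3 := two_mul_triangle j
    zify at *
    linarith
  have q1 := congrArg (q ^ ·) p1
  have q2 := congrArg (q ^ ·) p2
  simp only [pow_add _ _ (j * (j + 1) / 2)] at q1 q2
  rw [pow_add _ (d.choose 2)] at q1
  rw [pow_add _ ((2 * j + d + 1).choose 2)] at q2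
  have s1 : (-1 : R) ^ (2 * j + d + 1) = - (-1) ^ d := by
    rw [show 2 * j + d + 1 = 2 * j + (d + 1) by ring, pow_add, pow_mul]; simp [pow_succ]
  have s2 : (-1 : R) ^ (j + d) * (-1) ^ j = (-1) ^ d := by
    rw [← pow_add, show j + d + j = 2 * j + d by ring, pow_add, pow_mul]; simp
  rw [s1]
  push_cast
  linear_combination (exp := 1)
    (-(-1) ^ d * d * qBinom q (2 * (j + d) + 1) d) * q1
    + ((-1) ^ d * (2 * j + d + 1) * qBinom q (2 * (j + d) + 1) d) * q2
    - (2 * j + 1) * (q ^ ((j + d).choose 2 + (j + d) + (j + d) ^ 2) * q ^ (j * (j + 1) / 2))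
      * qBinom q (2 * (j + d) + 1) d * s2

end qBinom

/-! ### Euler's product and Jacobi's identity. -/

section euler
open PowerSeries.WithPiTopology

theorem PowerSeries.eq_of_X_pow_dvd_sub {R : Type*} [CommRing R] {f g : R⟦X⟧}
    (h : ∀ n, X ^ (n + 1) ∣ f - g) : f = g := by
  ext n
  have := X_pow_dvd_iff.mp (h n) n (by omega)
  simpa [sub_eq_zero] using this

theorem PowerSeries.coeff_eq_of_X_pow_dvd_sub {R : Type*} [CommRing R] {f g : R⟦X⟧} {n m : ℕ}
    (h : X ^ n ∣ f - g) (hm : m < n) : coeff m f = coeff m g := by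
  have := X_pow_dvd_iff.mp h m hm
  simpa [sub_eq_zero] using this

/-- Euler's product `∏ (1 - X ^ m)` over `m ≥ 1`. -/
noncomputable def euler : ℤ⟦X⟧ := ∏' n : ℕ, (1 - X ^ (n + 1))

theorem X_pow_dvd_qPoch_sub {R : Type*} [CommRing R] (x : R) {n m : ℕ} (h : n ≤ m) :
    x ^ (n + 1) ∣ qPoch x m - qPoch x n := by
  induction m, h using Nat.le_induction with
  | base => simp
  | succ m hm ih =>
    rw [qPoch_succ]
    have : qPoch x m * (1 - x ^ (m + 1)) - qPoch x n
        = (qPoch x m - qPoch x n) - qPoch x m * x ^ (m + 1) := by ring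
    rw [this]
    exact dvd_sub ih (Dvd.dvd.mul_left (pow_dvd_pow _ (by omega)) _)

theorem hasProd_euler : HasProd (fun n : ℕ => (1 - X ^ (n + 1) : ℤ⟦X⟧)) euler :=
  (multipliable_one_sub_X_pow ℤ).hasProd

theorem X_pow_dvd_euler_sub_self (n : ℕ) : (X : ℤ⟦X⟧) ^ (n + 1) ∣ euler - qPoch X n := by
  rw [X_pow_dvd_iff]
  intro d hd
  have ht := ((continuous_coeff ℤ d).tendsto _).comp hasProd_euler.tendsto_prod_nat
  have hc : Filter.Tendsto (fun m => coeff d (qPoch (X : ℤ⟦X⟧) m)) Filter.atTop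
      (nhds (coeff d (qPoch (X : ℤ⟦X⟧) n))) := by
    refine tendsto_const_nhds.congr' ?_
    filter_upwards [Filter.eventually_ge_atTop n] with m hm
    exact (coeff_eq_of_X_pow_dvd_sub (X_pow_dvd_qPoch_sub X hm) hd).symm
  rw [map_sub, sub_eq_zero]
  exact tendsto_nhds_unique ht hc

theorem X_pow_dvd_euler_sub {n m : ℕ} (h : n ≤ m) :
    (X : ℤ⟦X⟧) ^ (n + 1) ∣ euler - qPoch X m :=
  (pow_dvd_pow _ (by omega)).trans (X_pow_dvd_euler_sub_self m)

end euler

theorem constantCoeff_qPoch (n : ℕ) : constantCoeff (qPoch (X : ℤ⟦X⟧) n) = 1 := by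
  rw [qPoch_map]
  simp [qPoch]

theorem qPoch_X_ne_zero (n : ℕ) : qPoch (X : ℤ⟦X⟧) n ≠ 0 := fun h => by
  simpa [h] using constantCoeff_qPoch n

theorem constantCoeff_euler : constantCoeff euler = 1 := by
  have := coeff_eq_of_X_pow_dvd_sub (X_pow_dvd_euler_sub_self 0) zero_lt_one
  simpa using this

theorem mul_X_pow_dvd_cancel {u f : ℤ⟦X⟧} (hu : constantCoeff u = 1) {n : ℕ}
    (h : X ^ n ∣ u * f) : X ^ n ∣ f := by
  have : IsUnit u := by rw [isUnit_iff_constantCoeff, hu]; exact isUnit_one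
  exact (this.dvd_mul_left).mp h

/-- The binomial is a quotient of three finite products, each of which agrees with E modulo X ^ (a +
1). -/
theorem X_pow_dvd_qBinom_mul_euler (a b : ℕ) (h : a ≤ b) :
    (X : ℤ⟦X⟧) ^ (a + 1) ∣ qBinom X (a + b) a * euler - 1 := by
  apply mul_X_pow_dvd_cancel (constantCoeff_qPoch (a + b))
  have h1 := qBinom_mul_qPoch (X : ℤ⟦X⟧) a b
  have h2 := X_pow_dvd_euler_sub (le_refl a)
  have h3 := X_pow_dvd_euler_sub h
  have h4 := X_pow_dvd_euler_sub (show a ≤ a + b by omega)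
  have e : qPoch X (a + b) * (qBinom X (a + b) a * euler - 1)
      = qBinom X (a + b) a * euler * (-(euler - qPoch X (a + b)) + (euler - qPoch X b))
        + qBinom X (a + b) a * qPoch X b * (euler - qPoch X a) := by
    linear_combination h1
  rw [e]
  exact dvd_add ((dvd_add (h4.neg_right) h3).mul_left _) (h2.mul_left _)

theorem triangle_strictMono : StrictMono fun j : ℕ => j * (j + 1) / 2 :=
  strictMono_nat_of_lt_succ fun j => by simp only [triangle_succ]; omega

theorem le_triangle (j : ℕ) : j ≤ j * (j + 1) / 2 := triangle_strictMono.le_apply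

/-- In the finite identity times E, each binomial times E is 1 only modulo X ^ (n - j + 1); the
factor X ^ (j * (j + 1) / 2) makes up for the missing j. -/
theorem X_pow_dvd_euler_cube (n : ℕ) :
    (X : ℤ⟦X⟧) ^ (n + 1) ∣ euler ^ 3 -
      ∑ j ∈ range (n + 1), (-1) ^ j * (2 * (j : ℤ⟦X⟧) + 1) * X ^ (j * (j + 1) / 2) := by
  have h1 := X_pow_dvd_euler_sub (le_refl n)
  have h2 := qPoch_sq (X : ℤ⟦X⟧) X_ne_zero qPoch_X_ne_zero n
  have e : euler ^ 3 -
      ∑ j ∈ range (n + 1), (-1) ^ j * (2 * (j : ℤ⟦X⟧) + 1) * X ^ (j * (j + 1) / 2)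
      = euler * (euler + qPoch X n) * (euler - qPoch X n)
        + ∑ j ∈ range (n + 1), (-1) ^ j * (2 * (j : ℤ⟦X⟧) + 1) *
          (X ^ (j * (j + 1) / 2) * (qBinom X (2 * n + 1) (n - j) * euler - 1)) := by
    have : euler * (euler + qPoch X n) * (euler - qPoch X n)
      = euler ^ 3 - qPoch X n ^ 2 * euler := by ring
    rw [this, h2, sum_mul, sub_add, ← sum_sub_distrib]
    congr 1
    refine sum_congr rfl fun j _ => ?_
    ring
  rw [e]
  refine dvd_add (h1.mul_left _) (dvd_sum fun j hj => Dvd.dvd.mul_left ?_ _)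
  rw [mem_range] at hj
  have h3 := X_pow_dvd_qBinom_mul_euler (n - j) (n + j + 1) (by omega)
  rw [show n - j + (n + j + 1) = 2 * n + 1 by omega] at h3
  refine dvd_trans ?_ (mul_dvd_mul_left _ h3)
  rw [← pow_add]
  apply pow_dvd_pow
  have := le_triangle j
  omega

theorem coeff_euler_cube (m : ℕ) : coeff m (euler ^ 3) =
    ∑ j ∈ range (m + 1), if m = j * (j + 1) / 2 then (-1) ^ j * (2 * (j : ℤ) + 1) else 0 := by
  rw [coeff_eq_of_X_pow_dvd_sub (X_pow_dvd_euler_cube m) (Nat.lt_succ_self m), map_sum]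
  refine sum_congr rfl fun j _ => ?_
  have : (-1) ^ j * (2 * (j : ℤ⟦X⟧) + 1) = C ((-1) ^ j * (2 * (j : ℤ) + 1)) := by simp
  rw [this, coeff_C_mul, coeff_X_pow]
  simp

/-- Jacobi's identity for the cube of Euler's product. -/
theorem coeff_euler_cube_triangle (j : ℕ) :
    coeff (j * (j + 1) / 2) (euler ^ 3) = (-1) ^ j * (2 * (j : ℤ) + 1) := by
  rw [coeff_euler_cube, sum_eq_single_of_mem j]
  · simp
  · have := le_triangle j
    rw [mem_range]; omega
  · intro i _ hi
    rw [if_neg]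
    exact fun h => hi (triangle_strictMono.injective h.symm)

theorem coeff_euler_cube_eq_zero {m : ℕ} (h : ¬ ∃ j : ℕ, m = j * (j + 1) / 2) :
    coeff m (euler ^ 3) = 0 := by
  rw [coeff_euler_cube]
  exact sum_eq_zero fun j _ => if_neg fun hj => h ⟨j, hj⟩

/-! ### Trisection and the dissection of E³ modulo 3. -/

/-- The substitution `X ↦ X ^ 3`. -/
noncomputable abbrev cubeVar : ℤ⟦X⟧ →ₐ[ℤ] ℤ⟦X⟧ := expand 3 three_ne_zero

/-- The operator that keeps the coefficients with index divisible by three. -/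
noncomputable def sect : ℤ⟦X⟧ →+ ℤ⟦X⟧ where
  toFun f := PowerSeries.mk fun n => coeff (3 * n) f
  map_zero' := by ext; simp
  map_add' f g := by ext; simp

@[simp] theorem coeff_sect (n : ℕ) (f : ℤ⟦X⟧) : coeff n (sect f) = coeff (3 * n) f := by
  simp [sect]

theorem sect_cubeVar (f : ℤ⟦X⟧) : sect (cubeVar f) = f := by
  ext n; rw [coeff_sect, coeff_expand_mul]

theorem sect_cubeVar_mul (f g : ℤ⟦X⟧) : sect (cubeVar f * g) = f * sect g := by
  ext n
  rw [coeff_sect, coeff_mul, coeff_mul]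
  symm
  refine sum_of_injOn (fun p => (3 * p.1, 3 * p.2)) ?_ ?_ ?_ ?_
  · rintro ⟨a, b⟩ _ ⟨c, d⟩ _ h
    simp only [Prod.mk.injEq] at h ⊢
    omega
  · rintro ⟨a, b⟩ h
    simp only [mem_coe, HasAntidiagonal.mem_antidiagonal] at *
    omega
  · rintro ⟨a, b⟩ h h'
    simp only [HasAntidiagonal.mem_antidiagonal] at h
    rw [coeff_expand_of_not_dvd, zero_mul]
    rintro ⟨c, rfl⟩
    apply h'
    refine ⟨(c, n - c), ?_, ?_⟩
    · simp; omega
    · simp; omega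
  · rintro ⟨a, b⟩ _
    simp [coeff_expand_mul]

theorem sect_X_mul_cubeVar (f : ℤ⟦X⟧) : sect (X * cubeVar f) = 0 := by
  ext n
  rw [coeff_sect]
  obtain _ | n := n
  · simp
  · rw [show 3 * (n + 1) = 3 * n + 2 + 1 by ring, coeff_succ_X_mul,
      coeff_expand_of_not_dvd _ _ _ (by omega)]
    simp

theorem sect_X_sq_mul_cubeVar (f : ℤ⟦X⟧) : sect (X ^ 2 * cubeVar f) = 0 := by
  ext n
  rw [coeff_sect]
  obtain _ | n := n
  · simp
  · rw [show 3 * (n + 1) = 3 * n + 1 + 2 by ring, coeff_X_pow_mul,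
      coeff_expand_of_not_dvd _ _ _ (by omega)]
    simp

/-- The coefficients of index divisible by three of the cube of Euler's product. -/
noncomputable def eulerCubeSect : ℤ⟦X⟧ := sect (euler ^ 3)

/-- A triangular number is 1 modulo 3 exactly for j = 3i+1, and is 0 otherwise. For j = 3i+1 it
equals 9·i(i+1)/2 + 1, with Jacobi coefficient -3(-1)ⁱ(2i+1), so this class is again a Jacobi
series, in X⁹. -/
theorem euler_cube_eq :
    euler ^ 3 = cubeVar eulerCubeSect - 3 * X * cubeVar (cubeVar euler) ^ 3 := by
  have hC : (3 : ℤ⟦X⟧) = C 3 := by simp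
  rw [← map_pow, ← map_pow]
  ext n
  rw [map_sub, hC, mul_assoc, coeff_C_mul]
  obtain ⟨m, rfl | rfl | rfl⟩ : ∃ m, n = 3 * m ∨ n = 3 * m + 1 ∨ n = 3 * m + 2 :=
    ⟨n / 3, by omega⟩
  · rw [coeff_expand_mul, eulerCubeSect, coeff_sect]
    obtain _ | m := m
    · simp
    · rw [show 3 * (m + 1) = 3 * m + 2 + 1 by ring, coeff_succ_X_mul,
        coeff_expand_of_not_dvd _ _ _ (by omega)]
      simp
  · rw [coeff_expand_of_not_dvd _ _ _ (by omega), coeff_succ_X_mul, coeff_expand_mul]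
    by_cases h : ∃ j : ℕ, 3 * m + 1 = j * (j + 1) / 2
    · obtain ⟨j, hj⟩ := h
      rw [hj, coeff_euler_cube_triangle]
      have h2 := two_mul_triangle j
      rw [← hj] at h2
      obtain ⟨i, rfl | rfl | rfl⟩ : ∃ i, j = 3 * i ∨ j = 3 * i + 1 ∨ j = 3 * i + 2 :=
        ⟨j / 3, by omega⟩
      · ring_nf at h2; omega
      · have h3 := two_mul_triangle i
        have : m = 3 * (i * (i + 1) / 2) := by nlinarith
        rw [this, coeff_expand_mul, coeff_euler_cube_triangle, pow_succ, pow_mul]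
        push_cast
        norm_num
        ring
      · ring_nf at h2; omega
    · rw [coeff_euler_cube_eq_zero h]
      by_cases h3 : 3 ∣ m
      · obtain ⟨l, rfl⟩ := h3
        rw [coeff_expand_mul, coeff_euler_cube_eq_zero]
        · simp
        · rintro ⟨i, rfl⟩
          refine h ⟨3 * i + 1, ?_⟩
          have h3 := two_mul_triangle i
          have h4 := two_mul_triangle (3 * i + 1)
          nlinarith
      · rw [coeff_expand_of_not_dvd _ _ _ h3]; simp
  · rw [coeff_expand_of_not_dvd _ _ _ (by omega), show 3 * m + 2 = 3 * m + 1 + 1 by ring,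
      coeff_succ_X_mul, coeff_expand_of_not_dvd _ _ _ (by omega), coeff_euler_cube_eq_zero]
    · simp
    · rintro ⟨j, hj⟩
      have h2 := two_mul_triangle j
      rw [← hj] at h2
      obtain ⟨i, rfl | rfl | rfl⟩ : ∃ i, j = 3 * i ∨ j = 3 * i + 1 ∨ j = 3 * i + 2 :=
        ⟨j / 3, by omega⟩
      all_goals ring_nf at h2; omega

/-- The three conjugate factors of index k multiply to 1 - x^(3k) if 3 ∤ k and to (1 - x^k)³ if 3 ∣
k; the factor in x⁹ supplies the multiples of three missing from the former. -/
theorem qPoch_mul_qPoch_mul_qPoch {R : Type*} [CommRing R] {ω : R} (hω : ω ^ 2 + ω + 1 = 0)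
    (x : R) (n : ℕ) :
    qPoch x (3 * n) * qPoch (ω * x) (3 * n) * qPoch (ω ^ 2 * x) (3 * n) * qPoch (x ^ 9) n
      = qPoch (x ^ 3) (3 * n) * qPoch (x ^ 3) n ^ 3 := by
  have h3 : ω ^ 3 = 1 := by linear_combination (ω - 1) * hω
  have key : ∀ a : R, (1 - a) * (1 - ω * a) * (1 - ω ^ 2 * a) = 1 - a ^ 3 := by
    intro a
    linear_combination (-a + a ^ 2 * ω) * hω - a ^ 3 * h3
  induction n with
  | zero => simp
  | succ n ih =>
    have p0 : ω ^ (3 * n) = 1 := by rw [pow_mul, h3, one_pow]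
    have e1 : ω ^ (3 * n + 1) = ω := by rw [pow_add, p0]; ring
    have e2 : ω ^ (3 * n + 1 + 1) = ω ^ 2 := by rw [add_assoc, pow_add, p0]; ring
    have e3 : ω ^ (3 * n + 2 + 1) = 1 := by rw [add_assoc, pow_add, p0, h3]; ring
    have f1 : (ω ^ 2) ^ (3 * n + 1) = ω ^ 2 := by rw [← pow_mul, mul_comm, pow_mul, e1]
    have f2 : (ω ^ 2) ^ (3 * n + 1 + 1) = ω := by
      rw [← pow_mul, mul_comm, pow_mul, e2]; linear_combination ω * h3
    have f3 : (ω ^ 2) ^ (3 * n + 2 + 1) = 1 := by rw [← pow_mul, mul_comm, pow_mul, e3]; simp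
    have k1 := key (x ^ (3 * n + 1))
    have k2 := key (x ^ (3 * n + 1 + 1))
    rw [show 3 * (n + 1) = 3 * n + 1 + 1 + 1 by ring]
    simp only [qPoch_succ, mul_pow, e1, e2, e3, f1, f2, f3]
    rw [show (x ^ 3) ^ (3 * n + 1) = (x ^ (3 * n + 1)) ^ 3 by ring,
      show (x ^ 3) ^ (3 * n + 1 + 1) = (x ^ (3 * n + 1 + 1)) ^ 3 by ring,
      show (x ^ 3) ^ (3 * n + 1 + 1 + 1) = (x ^ 9) ^ (n + 1) by ring,
      show (x ^ 3) ^ (n + 1) = x ^ (3 * n + 1 + 1 + 1) by ring, ← k1, ← k2]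
    linear_combination (1 - x ^ (3 * n + 1)) * (1 - ω * x ^ (3 * n + 1))
      * (1 - ω ^ 2 * x ^ (3 * n + 1)) * (1 - x ^ (3 * n + 1 + 1)) * (1 - ω * x ^ (3 * n + 1 + 1))
      * (1 - ω ^ 2 * x ^ (3 * n + 1 + 1)) * (1 - (x ^ 9) ^ (n + 1))
      * (1 - x ^ (3 * n + 2 + 1)) ^ 3 * ih

theorem rescale_map_expand {ω : ℂ} (h3 : ω ^ 3 = 1) (f : ℤ⟦X⟧) :
    rescale ω (map (Int.castRingHom ℂ) (cubeVar f)) = map (Int.castRingHom ℂ) (cubeVar f) := by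
  ext n
  rw [coeff_rescale, coeff_map, coeff_expand]
  split_ifs with h
  · obtain ⟨m, rfl⟩ := h
    rw [pow_mul, h3]; simp
  · simp

theorem euler_norm {ω : ℂ} (hω : ω ^ 2 + ω + 1 = 0) :
    map (Int.castRingHom ℂ) euler * rescale ω (map (Int.castRingHom ℂ) euler)
      * rescale (ω ^ 2) (map (Int.castRingHom ℂ) euler)
      * map (Int.castRingHom ℂ) (cubeVar (cubeVar euler))
      = map (Int.castRingHom ℂ) (cubeVar euler) ^ 4 := by
  apply eq_of_X_pow_dvd_sub
  intro n
  rw [← Ideal.mem_span_singleton, ← Ideal.Quotient.eq]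
  set π := Ideal.Quotient.mk (Ideal.span {(X : ℂ⟦X⟧) ^ (n + 1)})
  have hπ : ∀ g : ℤ⟦X⟧ →+* ℂ⟦X⟧, X ∣ g X → ∀ m, n ≤ m → π (g euler) = π (qPoch (g X) m) := by
    intro g hg m hm
    rw [Ideal.Quotient.eq, Ideal.mem_span_singleton, ← qPoch_map, ← map_sub]
    refine (pow_dvd_pow_of_dvd hg _).trans ?_
    rw [← map_pow]
    exact map_dvd g (X_pow_dvd_euler_sub hm)
  have e1 := hπ (map (Int.castRingHom ℂ)) (by simp) (3 * n) (by omega)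
  have e2 := hπ ((rescale ω).comp (map (Int.castRingHom ℂ))) (by simp [rescale_X])
    (3 * n) (by omega)
  have e3 := hπ ((rescale (ω ^ 2)).comp (map (Int.castRingHom ℂ))) (by simp [rescale_X])
    (3 * n) (by omega)
  have e4 := hπ ((map (Int.castRingHom ℂ)).comp (cubeVar : ℤ⟦X⟧ →+* ℤ⟦X⟧))
    (by simp [pow_succ]) (3 * n) (by omega)
  have e5 := hπ ((map (Int.castRingHom ℂ)).comp (cubeVar : ℤ⟦X⟧ →+* ℤ⟦X⟧))
    (by simp [pow_succ]) n le_rfl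
  have e6 := hπ ((map (Int.castRingHom ℂ)).comp ((cubeVar : ℤ⟦X⟧ →+* ℤ⟦X⟧).comp
    (cubeVar : ℤ⟦X⟧ →+* ℤ⟦X⟧))) (by simp [pow_succ, mul_assoc]) n le_rfl
  simp only [RingHom.comp_apply, RingHom.coe_coe, expand_X, map_pow, map_X, rescale_X] at *
  have key := congrArg π (qPoch_mul_qPoch_mul_qPoch (ω := C ω)
    (by rw [← map_pow, ← map_add, ← map_one C, ← map_add, hω, map_zero]) X n)
  simp only [map_mul, map_pow] at key ⊢
  rw [e1, e2, e3, e6, show π ((map (Int.castRingHom ℂ)) (cubeVar euler)) ^ 4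
    = π ((map (Int.castRingHom ℂ)) (cubeVar euler)) * π ((map (Int.castRingHom ℂ)) (cubeVar euler)) ^ 3
    by ring]
  -- Of the four factors E(X³), one is truncated at 3n and three at n, as in the finite identity.
  nth_rw 1 [e4]
  rw [e5]
  simp only [← pow_mul] at *
  exact key

theorem exists_cube_root_of_unity : ∃ ω : ℂ, ω ^ 2 + ω + 1 = 0 := by
  obtain ⟨ω, hω⟩ : ∃ ω : ℂ, IsPrimitiveRoot ω 3 :=
    ⟨_, Complex.isPrimitiveRoot_exp 3 three_ne_zero⟩
  have h := hω.geom_sum_eq_zero (by norm_num)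
  simp only [sum_range_succ, sum_range_zero] at h
  exact ⟨ω, by linear_combination h⟩

/-- In E³ = P - 3XA³ the series P and A are invariant under X ↦ ωX, so the conjugates multiply to P³
- 27X³A⁹; `euler_norm` evaluates the same product. -/
theorem eulerCubeSect_cube :
    (cubeVar eulerCubeSect ^ 3 - 27 * X ^ 3 * cubeVar (cubeVar euler) ^ 9)
      * cubeVar (cubeVar euler) ^ 3 = cubeVar euler ^ 12 := by
  obtain ⟨ω, hω⟩ := exists_cube_root_of_unity
  have h3 : ω ^ 3 = 1 := by linear_combination (ω - 1) * hω
  apply map_injective (Int.castRingHom ℂ) Int.cast_injective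
  have h := euler_norm hω
  have h1 := congrArg (map (Int.castRingHom ℂ)) euler_cube_eq
  have h2 := congrArg (rescale ω) h1
  have h4 := congrArg (rescale (ω ^ 2)) h1
  have h6 : (ω ^ 2) ^ 3 = 1 := by rw [← pow_mul, mul_comm, pow_mul, h3, one_pow]
  have hC : C ω ^ 2 + C ω + 1 = 0 := by
    rw [← map_pow, ← map_add, ← map_one C, ← map_add, hω, map_zero]
  have hC3 : (C ω : ℂ⟦X⟧) ^ 3 = 1 := by rw [← map_pow, h3, map_one]
  simp only [map_sub, map_mul, map_pow, map_ofNat, map_X, rescale_X, rescale_map_expand h3,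
    rescale_map_expand h6] at *
  rw [show map (Int.castRingHom ℂ) (cubeVar euler) ^ 12
    = (map (Int.castRingHom ℂ) (cubeVar euler) ^ 4) ^ 3 by ring, ← h]
  rw [mul_pow, mul_pow, mul_pow, h1, h2, h4]
  generalize map (Int.castRingHom ℂ) (cubeVar eulerCubeSect) = P
  generalize map (Int.castRingHom ℂ) (cubeVar (cubeVar euler)) = A
  generalize C ω = c at *
  linear_combination (exp := 1) (3 * P ^ 2 * X * A ^ 3 - 9 * P * X ^ 2 * A ^ 6 * c) * A ^ 3 * hC
    + (27 * X ^ 3 * A ^ 9) * A ^ 3 * hC3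

/-! ### Modular functions h and w, and the equation between them. -/

/-- The inverse of Euler's product. -/
noncomputable def eulerInv : ℤ⟦X⟧ := invOfUnit euler 1

theorem euler_mul_eulerInv : euler * eulerInv = 1 :=
  mul_invOfUnit _ _ (by simp [constantCoeff_euler])

theorem constantCoeff_eulerInv : constantCoeff eulerInv = 1 := by
  have := congrArg constantCoeff euler_mul_eulerInv
  simpa [constantCoeff_euler] using this

theorem cubeVar_euler_mul_eulerInv : cubeVar euler * cubeVar eulerInv = 1 := by
  rw [← map_mul, euler_mul_eulerInv, map_one]

theorem cubeVar_cubeVar_euler_mul_eulerInv :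
    cubeVar (cubeVar euler) * cubeVar (cubeVar eulerInv) = 1 := by
  rw [← map_mul, cubeVar_euler_mul_eulerInv, map_one]

theorem cubeVar_X : cubeVar X = X ^ 3 := expand_X 3 three_ne_zero

/-- The series `X E(X ^ 9) ^ 3 / E(X) ^ 3`. -/
noncomputable def cubeQuot : ℤ⟦X⟧ := X * cubeVar (cubeVar euler) ^ 3 * eulerInv ^ 3

/-- The Hauptmodul `X E(X ^ 3) ^ 12 / E(X) ^ 12` of level three. -/
noncomputable def hauptmodul : ℤ⟦X⟧ := X * cubeVar euler ^ 12 * eulerInv ^ 12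

/-- The quotient of `hauptmodul` by `cubeQuot`. -/
noncomputable def hauptQuot : ℤ⟦X⟧ :=
  cubeVar euler ^ 12 * eulerInv ^ 9 * cubeVar (cubeVar eulerInv) ^ 3

theorem cubeVar_hauptmodul : cubeVar hauptmodul
    = X ^ 3 * cubeVar (cubeVar euler) ^ 12 * cubeVar eulerInv ^ 12 := by
  simp only [hauptmodul, map_mul, map_pow, cubeVar_X]

theorem cubeQuot_mul_hauptQuot : cubeQuot * hauptQuot = hauptmodul := by
  have h := pow_mul_pow_eq_one 3 cubeVar_cubeVar_euler_mul_eulerInv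
  simp only [cubeQuot, hauptQuot, hauptmodul]
  linear_combination X * cubeVar euler ^ 12 * eulerInv ^ 12 * h

theorem hauptQuot_mul_cubeVar_hauptmodul : hauptQuot * cubeVar hauptmodul = cubeQuot ^ 3 := by
  have h1 := pow_mul_pow_eq_one 12 cubeVar_euler_mul_eulerInv
  have h := pow_mul_pow_eq_one 3 cubeVar_cubeVar_euler_mul_eulerInv
  rw [cubeVar_hauptmodul]
  simp only [cubeQuot, hauptQuot]
  linear_combination X ^ 3 * cubeVar (cubeVar euler) ^ 9 * eulerInv ^ 9 *
    (h1 * cubeVar (cubeVar euler) ^ 3 * cubeVar (cubeVar eulerInv) ^ 3 + h)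

theorem hauptmodul_mul_cubeVar_hauptmodul : hauptmodul * cubeVar hauptmodul = cubeQuot ^ 4 := by
  nth_rw 1 [← cubeQuot_mul_hauptQuot]
  rw [mul_assoc, hauptQuot_mul_cubeVar_hauptmodul]; ring

/-- With P = E³(1+3w), the norm becomes E⁹((1+3w)³ - 27w³) = E⁹(1+9w+27w²). -/
theorem eulerInv_pow_nine : eulerInv ^ 9 =
    cubeVar (cubeVar euler ^ 3 * eulerInv ^ 12) * (1 + 9 * cubeQuot + 27 * cubeQuot ^ 2) := by
  have h := eulerCubeSect_cube
  have h0 : cubeVar eulerCubeSect = euler ^ 3 + 3 * X * cubeVar (cubeVar euler) ^ 3 := by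
    rw [euler_cube_eq]; ring
  rw [h0] at h
  have h3 := pow_mul_pow_eq_one 3 euler_mul_eulerInv
  have h1 := pow_mul_pow_eq_one 12 cubeVar_euler_mul_eulerInv
  simp only [map_mul, map_pow, cubeQuot] at *
  generalize cubeVar (cubeVar euler) = c at *
  generalize cubeVar euler = b at *
  generalize cubeVar eulerInv = b' at *
  generalize eulerInv = a' at *
  generalize euler = a at *
  have h6 : a ^ 6 * a' ^ 6 = 1 := by linear_combination (a ^ 3 * a' ^ 3 + 1) * h3
  have h9 : a ^ 9 * a' ^ 9 = 1 := by
    linear_combination (a ^ 6 * a' ^ 6 + a ^ 3 * a' ^ 3 + 1) * h3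
  linear_combination (exp := 1) -a' ^ 9 * b' ^ 12 * h - a' ^ 9 * h1
    + b' ^ 12 * c ^ 3 * (h9 + 9 * X * c ^ 3 * a' ^ 3 * h6 + 27 * X ^ 2 * c ^ 6 * a' ^ 6 * h3)

theorem cubeQuot_cube :
    cubeQuot ^ 3 = cubeVar hauptmodul * (1 + 9 * cubeQuot + 27 * cubeQuot ^ 2) := by
  have h := eulerInv_pow_nine
  have e : cubeQuot ^ 3 = X ^ 3 * cubeVar (cubeVar euler) ^ 9 * eulerInv ^ 9 := by
    rw [cubeQuot]; ring
  rw [e, h, cubeVar_hauptmodul]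
  simp only [map_mul, map_pow]
  ring

theorem sect_one : sect 1 = 1 := by
  conv_lhs => rw [← map_one cubeVar]
  exact sect_cubeVar 1

/-- E³ = P - 3XA³ divides P³ - 27X³A⁹, and the quotient P² + 3XPA³ + 9X²A⁶ displays the three
residue classes of w. -/
theorem cubeQuot_mul_cubeVar : cubeVar (euler ^ 12) * cubeQuot
    = X * cubeVar (cubeVar euler ^ 6 * eulerCubeSect ^ 2)
      + X ^ 2 * cubeVar (3 * eulerCubeSect * cubeVar euler ^ 9)
      + cubeVar (9 * X * cubeVar euler ^ 12) := by
  have h := eulerCubeSect_cube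
  have h0 := euler_cube_eq
  have h3 := pow_mul_pow_eq_one 3 euler_mul_eulerInv
  simp only [map_mul, map_pow, cubeQuot, map_ofNat, cubeVar_X] at *
  rw [h0] at h3
  linear_combination (exp := 1) -X * cubeVar (cubeVar euler) ^ 3 * eulerInv ^ 3 * h
    + X * cubeVar (cubeVar euler) ^ 6 * (cubeVar eulerCubeSect ^ 2
      + 3 * X * cubeVar eulerCubeSect * cubeVar (cubeVar euler) ^ 3
      + 9 * X ^ 2 * cubeVar (cubeVar euler) ^ 6) * h3

theorem sect_cubeQuot : sect cubeQuot = 9 * hauptmodul := by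
  have h := congrArg sect cubeQuot_mul_cubeVar
  rw [map_add, map_add, sect_X_mul_cubeVar, sect_X_sq_mul_cubeVar, sect_cubeVar,
    sect_cubeVar_mul] at h
  have h12 := pow_mul_pow_eq_one 12 euler_mul_eulerInv
  rw [hauptmodul]
  linear_combination eulerInv ^ 12 * h - sect cubeQuot * h12

theorem eulerCubeSect_pow : eulerCubeSect ^ 3 * cubeVar euler ^ 3
    = euler ^ 12 + 27 * X * cubeVar euler ^ 12 := by
  have h := eulerCubeSect_cube
  have : cubeVar (eulerCubeSect ^ 3 * cubeVar euler ^ 3)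
    = cubeVar (euler ^ 12 + 27 * X * cubeVar euler ^ 12) := by
    simp only [map_mul, map_pow, map_add, cubeVar_X, map_ofNat]
    linear_combination h
  rw [← sect_cubeVar (_ * _), this, sect_cubeVar]

/-- Squaring the dissection of w, class 0 receives one square and one cross term; the latter
contains P³, which `eulerCubeSect_pow` eliminates. -/
theorem sect_cubeQuot_sq : sect (cubeQuot ^ 2) = 6 * hauptmodul + 243 * hauptmodul ^ 2 := by
  have h1 : cubeVar (euler ^ 24) * cubeQuot ^ 2
      = X ^ 2 * cubeVar (cubeVar euler ^ 12 * eulerCubeSect ^ 4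
          + 54 * X * eulerCubeSect * cubeVar euler ^ 21)
        + X * cubeVar (27 * X * cubeVar euler ^ 18 * eulerCubeSect ^ 2)
        + cubeVar (6 * X * cubeVar euler ^ 12 * (eulerCubeSect ^ 3 * cubeVar euler ^ 3)
          + 81 * X ^ 2 * cubeVar euler ^ 24) := by
    have h := cubeQuot_mul_cubeVar
    have e : cubeVar (euler ^ 24) * cubeQuot ^ 2 = (cubeVar (euler ^ 12) * cubeQuot) ^ 2 := by
      simp only [map_pow]; ring
    rw [e, h]
    simp only [map_mul, map_pow, map_add, cubeVar_X, map_ofNat]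
    ring
  have h := congrArg sect h1
  rw [map_add, map_add, sect_X_mul_cubeVar, sect_X_sq_mul_cubeVar, sect_cubeVar,
    sect_cubeVar_mul, eulerCubeSect_pow] at h
  have h12 := pow_mul_pow_eq_one 12 euler_mul_eulerInv
  have h24 := pow_mul_pow_eq_one 24 euler_mul_eulerInv
  rw [hauptmodul]
  linear_combination (exp := 1) eulerInv ^ 24 * h - sect (cubeQuot ^ 2) * h24
    + 6 * X * cubeVar euler ^ 12 * eulerInv ^ 12 * h12

theorem hauptmodul_ne_zero : hauptmodul ≠ 0 := by
  intro h
  have h2 : X * (cubeVar euler ^ 12 * eulerInv ^ 12) = 0 := by rw [← h, hauptmodul]; ring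
  have h3 := congrArg constantCoeff ((mul_eq_zero.mp h2).resolve_left X_ne_zero)
  simp [constantCoeff_euler, constantCoeff_eulerInv] at h3

/-! ### Trisections of powers of w and their 3-adic size. -/

/-- The polynomials expressing the sections of the powers of `cubeQuot` in terms of
`hauptmodul`. -/
noncomputable def sectPoly : ℕ → Polynomial ℤ
  | 0 => 1
  | 1 => 9 * Polynomial.X
  | 2 => 6 * Polynomial.X + 243 * Polynomial.X ^ 2
  | i + 3 => Polynomial.X * (sectPoly i + 9 * sectPoly (i + 1) + 27 * sectPoly (i + 2))

theorem sect_ofNat_mul (n : ℕ) (f : ℤ⟦X⟧) : sect (n * f) = n * sect f := by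
  rw [← nsmul_eq_mul, map_nsmul, nsmul_eq_mul]

theorem sect_cubeQuot_pow (i : ℕ) :
    sect (cubeQuot ^ i) = Polynomial.aeval hauptmodul (sectPoly i) := by
  induction i using Nat.strong_induction_on with
  | _ i ih =>
    match i with
    | 0 => simp [sectPoly, sect_one]
    | 1 => simp [sectPoly, sect_cubeQuot, map_ofNat]
    | 2 => simp [sectPoly, sect_cubeQuot_sq, map_ofNat]
    | i + 3 =>
      have e : cubeQuot ^ (i + 3) = cubeVar hauptmodul * (cubeQuot ^ i
          + (9 : ℕ) * cubeQuot ^ (i + 1) + (27 : ℕ) * cubeQuot ^ (i + 2)) := by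
        rw [pow_add, cubeQuot_cube]; push_cast; ring
      rw [e, sect_cubeVar_mul, map_add, map_add, sect_ofNat_mul, sect_ofNat_mul,
        ih i (by omega), ih (i + 1) (by omega), ih (i + 2) (by omega), sectPoly]
      simp [map_ofNat]

theorem coeff_sectPoly_add_three (i j : ℕ) : (sectPoly (i + 3)).coeff (j + 1)
    = (sectPoly i).coeff j + 9 * (sectPoly (i + 1)).coeff j
      + 27 * (sectPoly (i + 2)).coeff j := by
  rw [sectPoly, Polynomial.coeff_X_mul]
  simp [Polynomial.coeff_ofNat_mul]

theorem coeff_sectPoly_eq_zero {i j : ℕ} (h : 3 * j < i) : (sectPoly i).coeff j = 0 := by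
  induction i using Nat.strong_induction_on generalizing j with
  | _ i ih =>
    match i, j with
    | 0, _ => omega
    | 1, 0 => simp [sectPoly]
    | 2, 0 => simp [sectPoly]
    | i + 3, 0 => simp [sectPoly]
    | 1, j + 1 => omega
    | 2, j + 1 => omega
    | i + 3, j + 1 =>
      rw [coeff_sectPoly_add_three, ih i (by omega) (by omega), ih (i + 1) (by omega) (by omega),
        ih (i + 2) (by omega) (by omega)]
      simp

/-- The valuation bound 3j - i, written without subtraction. It propagates because the factors 9 and
27 of the recursion outweigh the losses 1 and 2 from the indices i+1 and i+2. -/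
theorem pow_dvd_coeff_sectPoly (i j : ℕ) :
    (3 : ℤ) ^ (3 * j) ∣ 3 ^ i * (sectPoly i).coeff j := by
  induction i using Nat.strong_induction_on generalizing j with
  | _ i ih =>
    match i, j with
    | _, 0 => simp
    | 0, j + 1 => simp [sectPoly, Polynomial.coeff_one]
    | 1, 1 => norm_num [sectPoly]
    | 1, j + 2 => simp [sectPoly, Polynomial.coeff_X]
    | 2, 1 => norm_num [sectPoly, Polynomial.coeff_X, Polynomial.coeff_X_pow]
    | 2, 2 => norm_num [sectPoly, Polynomial.coeff_X, Polynomial.coeff_X_pow]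
    | 2, j + 3 => simp [sectPoly, Polynomial.coeff_X, Polynomial.coeff_X_pow]
    | i + 3, j + 1 =>
      have h0 := ih i (by omega) j
      have h1 := ih (i + 1) (by omega) j
      have h2 := ih (i + 2) (by omega) j
      have e : (3 : ℤ) ^ (i + 3) * (sectPoly (i + 3)).coeff (j + 1)
          = 3 ^ 3 * (3 ^ i * (sectPoly i).coeff j + 3 * (3 ^ (i + 1) * (sectPoly (i + 1)).coeff j)
            + 3 * (3 ^ (i + 2) * (sectPoly (i + 2)).coeff j)) := by
        rw [coeff_sectPoly_add_three]; ring
      rw [e, mul_add 3 j 1, mul_one, add_comm, pow_add]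
      exact mul_dvd_mul_left _ (dvd_add (dvd_add h0 (h1.mul_left _)) (h2.mul_left _))

/-- A polynomial whose `j`-th coefficient is divisible by `3 ^ (e + 3 * j)`, with constant
coefficient congruent to `c` modulo `3 ^ (e + 2)`. -/
def HasLead (e : ℕ) (c : ℤ) (p : Polynomial ℤ) : Prop :=
  (∀ j, (3 : ℤ) ^ (e + 3 * j) ∣ p.coeff j) ∧ (3 : ℤ) ^ (e + 2) ∣ p.coeff 0 - c

theorem sect_intCast_mul (n : ℤ) (f : ℤ⟦X⟧) : sect (n * f) = n * sect f := by
  rw [← zsmul_eq_mul, map_zsmul, zsmul_eq_mul]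

/-- Multiplying s hʲ by h(X³)^(j+t) turns it into w^(4j+a), whose trisection is known; h^(j+t) is
then cancelled, and the vanishing of low coefficients leaves the factor h^r. -/
theorem exists_sect_mul_aeval {s : ℤ⟦X⟧} {a t r : ℕ} (hs : s * cubeVar hauptmodul ^ t = cubeQuot ^ a)
    (h : 3 * (t + r) < a + 3) (p : Polynomial ℤ) :
    ∃ p' : Polynomial ℤ, sect (s * Polynomial.aeval hauptmodul p)
        = hauptmodul ^ r * Polynomial.aeval hauptmodul p' ∧
      ∀ l, p'.coeff l = ∑ j ∈ range (p.natDegree + 1),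
        p.coeff j * (sectPoly (4 * j + a)).coeff (l + (j + (t + r))) := by
  have hq : ∀ j, ∃ q, sectPoly (4 * j + a) = Polynomial.X ^ (j + (t + r)) * q := fun j =>
    Polynomial.X_pow_dvd_iff.mpr fun d hd => coeff_sectPoly_eq_zero (by omega)
  choose q hq using hq
  have hsj : ∀ j, sect (s * hauptmodul ^ j)
      = hauptmodul ^ r * Polynomial.aeval hauptmodul (q j) := by
    intro j
    apply mul_left_cancel₀ (pow_ne_zero (j + t) hauptmodul_ne_zero)
    have e : cubeVar (hauptmodul ^ (j + t)) * (s * hauptmodul ^ j) = cubeQuot ^ (4 * j + a) := by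
      rw [pow_add _ (4 * j), ← hs, pow_mul, ← hauptmodul_mul_cubeVar_hauptmodul, map_pow]
      ring
    rw [← sect_cubeVar_mul, e, sect_cubeQuot_pow, hq, map_mul, map_pow, Polynomial.aeval_X]
    ring
  refine ⟨∑ j ∈ range (p.natDegree + 1), Polynomial.C (p.coeff j) * q j, ?_, fun l => ?_⟩
  · rw [Polynomial.aeval_eq_sum_range, mul_sum, map_sum, map_sum, mul_sum]
    refine sum_congr rfl fun j _ => ?_
    rw [mul_smul_comm, Algebra.smul_def, eq_intCast, sect_intCast_mul, hsj, map_mul,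
      Polynomial.aeval_C, eq_intCast]
    ring
  · rw [Polynomial.finsetSum_coeff]
    refine sum_congr rfl fun j _ => ?_
    rw [Polynomial.coeff_C_mul, hq, Polynomial.coeff_X_pow_mul]

theorem exists_sect_hasLead {s : ℤ⟦X⟧} {a t r e e' : ℕ} {c : ℤ} {p : Polynomial ℤ}
    (hp : HasLead e c p) (hs : s * cubeVar hauptmodul ^ t = cubeQuot ^ a)
    (h : 3 * (t + r) < a + 3) (he : e' + a = e + 3 * (t + r)) :
    ∃ p' : Polynomial ℤ, sect (s * Polynomial.aeval hauptmodul p)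
        = hauptmodul ^ r * Polynomial.aeval hauptmodul p' ∧
      HasLead e' (c * (sectPoly a).coeff (t + r)) p' := by
  obtain ⟨p', h1, h2⟩ := exists_sect_mul_aeval hs h p
  -- The exponent is (e+3j) + 3(l+j+t+r) - (4j+a). The surplus 2j removes all terms with j ≥ 1 from
  -- the constant coefficient modulo 3 ^ (e' + 2), which is why `HasLead` uses that modulus.
  have key : ∀ j l, (3 : ℤ) ^ (e' + 3 * l + 2 * j) ∣
      p.coeff j * (sectPoly (4 * j + a)).coeff (l + (j + (t + r))) := by
    intro j l
    have d := mul_dvd_mul (hp.1 j) (pow_dvd_coeff_sectPoly (4 * j + a) (l + (j + (t + r))))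
    rw [← pow_add, show e + 3 * j + 3 * (l + (j + (t + r)))
      = (4 * j + a) + (e' + 3 * l + 2 * j) by omega, pow_add, mul_left_comm] at d
    exact (mul_dvd_mul_iff_left (by positivity)).mp d
  refine ⟨p', h1, fun l => ?_, ?_⟩
  · rw [h2]
    exact dvd_sum fun j _ => (pow_dvd_pow _ (by omega)).trans (key j l)
  · rw [h2, sum_range_succ', add_sub_assoc]
    refine dvd_add (dvd_sum fun j _ => (pow_dvd_pow _ (by omega)).trans (key (j + 1) 0)) ?_
    have d := mul_dvd_mul hp.2 (pow_dvd_coeff_sectPoly a (t + r))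
    rw [← pow_add, show e + 2 + 3 * (t + r) = a + (e' + 2) by omega, pow_add, mul_left_comm] at d
    have d2 := (mul_dvd_mul_iff_left (by positivity)).mp d
    rw [sub_mul] at d2
    simpa using d2

theorem coeff_sectPoly_two : (sectPoly 2).coeff 1 = 6 := by
  norm_num [sectPoly, Polynomial.coeff_X, Polynomial.coeff_X_pow]

theorem coeff_sectPoly_three : (sectPoly 3).coeff 1 = 1 := by
  rw [coeff_sectPoly_add_three 0 0, coeff_sectPoly_eq_zero (i := 0 + 1) (by omega),
    coeff_sectPoly_eq_zero (i := 0 + 2) (by omega)]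
  simp [sectPoly]

theorem coeff_sectPoly_four : (sectPoly 4).coeff 2 = 90 := by
  rw [coeff_sectPoly_add_three 1 1, coeff_sectPoly_two, coeff_sectPoly_three]
  norm_num [sectPoly]

theorem coeff_sectPoly_five : (sectPoly 5).coeff 2 = 15 := by
  rw [coeff_sectPoly_add_three 2 1, coeff_sectPoly_two, coeff_sectPoly_three,
    coeff_sectPoly_eq_zero (i := 2 + 2) (by omega)]
  norm_num

/-! ### The two inductions, on α and on β. -/

theorem exists_iterate_sect (α : ℕ) : ∃ p : Polynomial ℤ,
    (fun f => sect (X * sect f))^[α] (sect (X * eulerInv ^ 3))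
      = cubeVar eulerInv ^ 3 * (hauptmodul * Polynomial.aeval hauptmodul p) ∧
    HasLead (3 * α + 2) (5 ^ α * 3 ^ (3 * α + 2)) p := by
  have hc := pow_mul_pow_eq_one 3 cubeVar_cubeVar_euler_mul_eulerInv
  have hX : ∀ g : ℤ⟦X⟧, sect (X * (eulerInv ^ 3 * g))
      = cubeVar eulerInv ^ 3 * sect (cubeQuot * g) := by
    intro g
    rw [← map_pow, ← sect_cubeVar_mul, cubeQuot]
    congr 1
    simp only [map_pow]
    linear_combination -X * eulerInv ^ 3 * g * hc
  induction α with
  | zero =>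
    refine ⟨Polynomial.C 9, ?_, fun j => ?_, ?_⟩
    · have := hX 1
      simp only [mul_one] at this
      rw [Function.iterate_zero_apply, this, sect_cubeQuot, Polynomial.aeval_C]
      simp [mul_comm]
    · obtain _ | j := j
      · norm_num
      · simp
    · norm_num
  | succ α ih =>
    obtain ⟨p, h1, h2⟩ := ih
    -- Here h·h(X³) = w⁴: constant factor 90, exponent up by 2.
    obtain ⟨p', h3, h4⟩ := exists_sect_hasLead (s := hauptmodul) (a := 4) (t := 1) (r := 1)
      (e' := 3 * α + 4) h2 (by rw [pow_one, hauptmodul_mul_cubeVar_hauptmodul]) (by omega) (by omega)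
    -- The prefactor, now E⁻³, contributes a further w, giving w⁵: constant factor 15, exponent up
    -- by 1.
    obtain ⟨p'', h5, h6⟩ := exists_sect_hasLead (s := cubeQuot * hauptmodul) (a := 5) (t := 1)
      (r := 1) (e' := 3 * (α + 1) + 2) h4
      (by rw [pow_one, mul_assoc, hauptmodul_mul_cubeVar_hauptmodul]; ring) (by omega) (by omega)
    refine ⟨p'', ?_, h6.1, ?_⟩
    · rw [Function.iterate_succ_apply', h1, ← map_pow, sect_cubeVar_mul, h3, pow_one, hX,
        ← mul_assoc cubeQuot, h5, pow_one, map_pow]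
    · have h7 := h6.2
      rw [coeff_sectPoly_four, coeff_sectPoly_five] at h7
      -- 90·15 = 27·50, and 50 may be replaced by 5 since they differ by 45, a multiple of 9.
      have e : p''.coeff 0 - 5 ^ (α + 1) * 3 ^ (3 * (α + 1) + 2)
          = (p''.coeff 0 - 5 ^ α * 3 ^ (3 * α + 2) * 90 * 15)
            + 3 ^ (3 * (α + 1) + 2 + 2) * (5 ^ (α + 1)) := by ring
      rw [e]
      exact dvd_add h7 (dvd_mul_right _ _)

/-- The operator that keeps the coefficients with index congruent to one modulo three. -/
noncomputable def sectOne (f : ℤ⟦X⟧) : ℤ⟦X⟧ := PowerSeries.mk fun n => coeff (3 * n + 1) f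

@[simp] theorem coeff_sectOne (n : ℕ) (f : ℤ⟦X⟧) :
    coeff n (sectOne f) = coeff (3 * n + 1) f := by
  simp [sectOne]

theorem sectOne_X_mul (f : ℤ⟦X⟧) : sectOne (X * f) = sect f := by
  ext n; rw [coeff_sectOne, coeff_succ_X_mul, coeff_sect]

/-- The series is X times a series in X³ times `hauptQuot` and the polynomial. As `hauptQuot`·h(X³)
= w³ has constant factor 1, exponent and lead are unchanged. -/
theorem exists_sectOne_hasLead {e : ℕ} {c : ℤ} {p : Polynomial ℤ} (hp : HasLead e c p) :
    ∃ p' : Polynomial ℤ, sectOne (euler ^ 3 * cubeVar eulerInv ^ 6 *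
        (hauptmodul * Polynomial.aeval hauptmodul p))
        = eulerInv ^ 6 * cubeVar euler ^ 3 * Polynomial.aeval hauptmodul p' ∧ HasLead e c p' := by
  obtain ⟨p', h1, h2⟩ := exists_sect_hasLead (s := hauptQuot) (a := 3) (t := 1) (r := 0)
    (e' := e) hp (by rw [pow_one, hauptQuot_mul_cubeVar_hauptmodul]) (by omega) (by omega)
  refine ⟨p', ?_, ?_⟩
  · have h3 := pow_mul_pow_eq_one 3 euler_mul_eulerInv
    have h9 := pow_mul_pow_eq_one 3 cubeVar_cubeVar_euler_mul_eulerInv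
    have e : euler ^ 3 * cubeVar eulerInv ^ 6 * (hauptmodul * Polynomial.aeval hauptmodul p)
        = X * (cubeVar (eulerInv ^ 6 * cubeVar euler ^ 3)
          * (hauptQuot * Polynomial.aeval hauptmodul p)) := by
      simp only [map_mul, map_pow]
      generalize Polynomial.aeval hauptmodul p = g
      simp only [hauptmodul, hauptQuot]
      linear_combination X * cubeVar eulerInv ^ 6 * cubeVar euler ^ 12 * eulerInv ^ 9 * g
        * (h3 - h9)
    rw [e, sectOne_X_mul, sect_cubeVar_mul, h1, pow_zero, one_mul]
  · simpa [coeff_sectPoly_three] using h2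

/-- The prefactor times X² is a series in X³ times w²; the constant factor 6 accounts for one power
of 3 and one of 2 per round. -/
theorem exists_sect_X_sq_hasLead {e : ℕ} {c : ℤ} {p : Polynomial ℤ} (hp : HasLead e c p) :
    ∃ p' : Polynomial ℤ, sect (X ^ 2 * (eulerInv ^ 6 * cubeVar euler ^ 3 *
        Polynomial.aeval hauptmodul p)) = euler ^ 3 * cubeVar eulerInv ^ 6 *
          (hauptmodul * Polynomial.aeval hauptmodul p') ∧ HasLead (e + 1) (c * 6) p' := by
  obtain ⟨p', h1, h2⟩ := exists_sect_hasLead (s := cubeQuot ^ 2) (a := 2) (t := 0) (r := 1)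
    (e' := e + 1) hp (by rw [pow_zero, mul_one]) (by omega) (by omega)
  refine ⟨p', ?_, ?_⟩
  · have h9 := pow_mul_pow_eq_one 6 cubeVar_cubeVar_euler_mul_eulerInv
    have e : X ^ 2 * (eulerInv ^ 6 * cubeVar euler ^ 3 * Polynomial.aeval hauptmodul p)
        = cubeVar (euler ^ 3 * cubeVar eulerInv ^ 6)
          * (cubeQuot ^ 2 * Polynomial.aeval hauptmodul p) := by
      simp only [map_mul, map_pow]
      generalize Polynomial.aeval hauptmodul p = g
      simp only [cubeQuot]
      linear_combination -X ^ 2 * eulerInv ^ 6 * cubeVar euler ^ 3 * g * h9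
    rw [e, sect_cubeVar_mul, h1, pow_one]
  · simpa [coeff_sectPoly_two] using h2

theorem exists_iterate_sectOne (α β : ℕ) : ∃ p : Polynomial ℤ,
    (fun f => sect (X ^ 2 * sectOne f))^[β] (euler ^ 3 * cubeVar eulerInv ^ 3 *
      (fun f => sect (X * sect f))^[α] (sect (X * eulerInv ^ 3)))
      = euler ^ 3 * cubeVar eulerInv ^ 6 * (hauptmodul * Polynomial.aeval hauptmodul p) ∧
    HasLead (3 * α + β + 2) (2 ^ β * 5 ^ α * 3 ^ (3 * α + β + 2)) p := by
  induction β with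
  | zero =>
    obtain ⟨p, h1, h2⟩ := exists_iterate_sect α
    refine ⟨p, ?_, by simpa using h2⟩
    rw [Function.iterate_zero_apply, h1]
    ring
  | succ β ih =>
    obtain ⟨p, h1, h2⟩ := ih
    obtain ⟨p', h3, h4⟩ := exists_sectOne_hasLead h2
    obtain ⟨p'', h5, h6⟩ := exists_sect_X_sq_hasLead h4
    refine ⟨p'', ?_, ?_⟩
    · rw [Function.iterate_succ_apply', h1, h3, h5]
    · have e : (2 : ℤ) ^ (β + 1) * 5 ^ α * 3 ^ (3 * α + (β + 1) + 2)
          = 2 ^ β * 5 ^ α * 3 ^ (3 * α + β + 2) * 6 := by ring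
      rw [e]
      exact h6

theorem three_dvd_cubeVar_sub_pow (f : ℤ⟦X⟧) : (3 : ℤ⟦X⟧) ∣ cubeVar f - f ^ 3 := by
  have h : map (Int.castRingHom (ZMod 3)) (cubeVar f - f ^ 3) = 0 := by
    rw [map_sub, map_pow, map_expand, sub_eq_zero]
    have := MvPowerSeries.map_frobenius_expand 3 three_ne_zero
      (f := map (Int.castRingHom (ZMod 3)) f)
    rw [ZMod.frobenius_zmod] at this
    exact this
  have hC : (3 : ℤ⟦X⟧) = C 3 := by simp
  have hd : ∀ n, (3 : ℤ) ∣ coeff n (cubeVar f - f ^ 3) := by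
    intro n
    have := congrArg (coeff n) h
    rw [coeff_map] at this
    exact (ZMod.intCast_zmod_eq_zero_iff_dvd _ 3).mp (by simpa using this)
  choose g hg using hd
  refine ⟨PowerSeries.mk g, ?_⟩
  ext n
  rw [hC, coeff_C_mul, coeff_mk, hg]

/-! ### The generating function of the partition triples. -/

theorem allowedPart_iff (k i : ℕ) : AllowedPart k i ↔ ¬ (3 ^ k ∣ i ∧ ¬ 3 ^ (k + 1) ∣ i) := by
  have hz : (3 : ℤ) ^ k ≠ 0 := by positivity
  have hdvd : ∀ m : ℕ, 3 ^ m ∣ i ↔ (3 : ℤ) ^ m ∣ (i : ℤ) := fun m => by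
    rw [← Int.natCast_dvd_natCast]; push_cast; rfl
  rw [AllowedPart, not_iff_not, hdvd, hdvd]
  by_cases h : (3 : ℤ) ^ k ∣ (i : ℤ)
  · obtain ⟨c, hc⟩ := h
    rw [hc, Int.modEq_iff_dvd, Int.modEq_iff_dvd, pow_succ,
      show (3 : ℤ) ^ k - 3 ^ k * c = 3 ^ k * (1 - c) by ring,
      show -(3 : ℤ) ^ k - 3 ^ k * c = 3 ^ k * (-1 - c) by ring,
      mul_dvd_mul_iff_left hz, mul_dvd_mul_iff_left hz, mul_dvd_mul_iff_left hz]
    simp only [dvd_mul_right, true_and]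
    omega
  · simp only [h, false_and, iff_false, not_or, Int.modEq_iff_dvd]
    have hp : (3 : ℤ) ^ k ∣ 3 ^ (k + 1) := pow_dvd_pow _ (by omega)
    exact ⟨fun h' => h ((dvd_sub_right dvd_rfl).mp (hp.trans h')),
      fun h' => h ((dvd_sub_right (dvd_neg.mpr dvd_rfl)).mp (hp.trans h'))⟩

section product
open PowerSeries.WithPiTopology

theorem continuous_expand (m : ℕ) (hm : m ≠ 0) : Continuous (expand m hm : ℤ⟦X⟧ → ℤ⟦X⟧) := by
  refine continuous_pi fun d => ?_
  have h : ∀ n, Continuous fun f : ℤ⟦X⟧ => coeff n (expand m hm f) := by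
    intro n
    simp only [coeff_expand]
    split_ifs
    · exact continuous_coeff ℤ _
    · exact continuous_const
  have e : d = Finsupp.single () (d ()) := by ext; simp
  rw [e]
  exact h (d ())

theorem hasProd_expand_euler (m : ℕ) (hm : m ≠ 0) :
    HasProd (fun i : ℕ => if m ∣ i + 1 then (1 - X ^ (i + 1) : ℤ⟦X⟧) else 1)
      (expand m hm euler) := by
  have h := hasProd_euler.map (expand m hm) (continuous_expand m hm)
  have hg : Function.Injective fun n : ℕ => m * (n + 1) - 1 := by
    intro a b hab
    have ha : 0 < m * (a + 1) := by positivity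
    have hb : 0 < m * (b + 1) := by positivity
    have : m * (a + 1) = m * (b + 1) := by simp only at hab; omega
    simpa [hm] using this
  rw [← hg.hasProd_iff]
  · have e : (fun i : ℕ => if m ∣ i + 1 then (1 - X ^ (i + 1) : ℤ⟦X⟧) else 1)
        ∘ (fun n : ℕ => m * (n + 1) - 1)
        = (expand m hm : ℤ⟦X⟧ → ℤ⟦X⟧) ∘ fun n : ℕ => 1 - X ^ (n + 1) := by
      funext n
      have ha : 0 < m * (n + 1) := by positivity
      simp only [Function.comp_apply]
      rw [Nat.sub_add_cancel ha, if_pos (dvd_mul_right _ _)]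
      simp [pow_mul]
    rw [e]
    exact h
  · intro i hi
    rw [if_neg]
    rintro ⟨c, hc⟩
    obtain _ | c := c
    · simp at hc
    · exact hi ⟨c, by simp only; omega⟩

/-- The generating function of the partitions without parts congruent to `± 3 ^ k` modulo
`3 ^ (k + 1)`. -/
theorem mk_card_restricted_mul (k : ℕ) :
    PowerSeries.mk (fun n => (#(Nat.Partition.restricted n (AllowedPart k)) : ℤ)) * euler
      * expand (3 ^ (k + 1)) (by positivity) euler = expand (3 ^ k) (by positivity) euler := by
  refine HasProd.unique (f := fun i : ℕ => if 3 ^ k ∣ i + 1 then (1 - X ^ (i + 1) : ℤ⟦X⟧) else 1)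
    ?_ (hasProd_expand_euler (3 ^ k) (by positivity))
  refine (((Nat.Partition.hasProd_powerSeriesMk_card_restricted ℤ (AllowedPart k)).mul
    hasProd_euler).mul (hasProd_expand_euler (3 ^ (k + 1)) (by positivity))).congr_fun fun i => ?_
  have h1 : (∑' j : ℕ, X ^ ((i + 1) * j)) * (1 - X ^ (i + 1) : ℤ⟦X⟧) = 1 := by
    simp only [pow_mul]
    exact tsum_pow_mul_one_sub_of_constantCoeff_eq_zero (by simp)
  have h2 : 3 ^ (k + 1) ∣ i + 1 → 3 ^ k ∣ i + 1 := (pow_dvd_pow _ (by omega)).trans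
  have h3 := allowedPart_iff k (i + 1)
  by_cases ha : 3 ^ k ∣ i + 1 <;> by_cases hb : 3 ^ (k + 1) ∣ i + 1
  · rw [if_pos (h3.mpr (by tauto)), if_pos ha, if_pos hb, h1, one_mul]
  · have hc : ¬ AllowedPart k (i + 1) := by tauto
    rw [if_neg hc, if_pos ha, if_neg hb, one_mul, mul_one]
  · tauto
  · rw [if_pos (h3.mpr (by tauto)), if_neg ha, if_neg hb, h1, one_mul]

end product

theorem pmT_eq_coeff (k n : ℕ) : (pmT k n : ℤ) = coeff n
    (PowerSeries.mk (fun n => (#(Nat.Partition.restricted n (AllowedPart k)) : ℤ)) ^ 3) := by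
  rw [pmT, pmTriples, card_sigma]
  simp only [Fintype.card_piFinset, Fin.prod_univ_three]
  push_cast
  rw [pow_three', coeff_mul]
  simp only [coeff_mul, coeff_mk, sum_mul]
  rw [sum_sigma']
  refine sum_bij' (fun x _ => ⟨(x 0 + x 1, x 2), (x 0, x 1)⟩)
    (fun p _ => ![p.2.1, p.2.2, p.1.2]) ?_ ?_ ?_ ?_ ?_
  · intro x hx
    rw [Finset.Nat.mem_antidiagonalTuple, Fin.sum_univ_three] at hx
    simp [hx]
  · rintro ⟨⟨a, b⟩, c, d⟩ h
    simp only [mem_sigma, HasAntidiagonal.mem_antidiagonal] at h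
    simp [Finset.Nat.mem_antidiagonalTuple, Fin.sum_univ_three, h.1, h.2]
  · intro x _
    ext i
    fin_cases i <;> rfl
  · rintro ⟨⟨a, b⟩, c, d⟩ h
    simp only [mem_sigma, HasAntidiagonal.mem_antidiagonal] at h
    simp [h.2]
  · intro x _
    rfl

/-- The generating function of the partition triples without parts congruent to `± 3 ^ k` modulo
`3 ^ (k + 1)`. -/
theorem mk_pmT (k : ℕ) : PowerSeries.mk (fun n => (pmT k n : ℤ)) =
    eulerInv ^ 3 * expand (3 ^ k) (by positivity) (euler ^ 3 * cubeVar eulerInv ^ 3) := by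
  have h1 := mk_card_restricted_mul k
  have h2 : PowerSeries.mk (fun n => (pmT k n : ℤ))
    = PowerSeries.mk (fun n => (#(Nat.Partition.restricted n (AllowedPart k)) : ℤ)) ^ 3 := by
    ext n; rw [coeff_mk, pmT_eq_coeff]
  have h3 := euler_mul_eulerInv
  have h4 := congrArg (expand (3 ^ k) (by positivity) ∘ cubeVar) h3
  simp only [Function.comp_apply, map_mul, map_one] at h4
  have h5 : expand (3 ^ (k + 1)) (by positivity) euler
    = expand (3 ^ k) (by positivity) (cubeVar euler) := expand_mul (3 ^ k) (by positivity) 3 _ _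
  rw [h5] at h1
  rw [h2]
  simp only [map_mul, map_pow]
  rw [← h1]
  simp only [← mul_pow]
  congr 1
  generalize PowerSeries.mk _ = r at *
  linear_combination -r * eulerInv * euler * h4 - r * h3

/-! ### Congruences for the coefficients. -/

theorem pow_dvd_coeff {e : ℕ} {f : ℤ⟦X⟧} (h : (3 : ℤ⟦X⟧) ^ e ∣ f) (n : ℕ) :
    (3 : ℤ) ^ e ∣ coeff n f := by
  obtain ⟨g, rfl⟩ := h
  rw [show (3 : ℤ⟦X⟧) ^ e = C (3 ^ e) by simp, coeff_C_mul]
  exact dvd_mul_right _ _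

theorem pow_dvd_aeval_of_coeff {e : ℕ} {p : Polynomial ℤ} (y : ℤ⟦X⟧)
    (h : ∀ j, (3 : ℤ) ^ e ∣ p.coeff j) : (3 : ℤ⟦X⟧) ^ e ∣ Polynomial.aeval y p := by
  obtain ⟨q, rfl⟩ := (Polynomial.C_dvd_iff_dvd_coeff _ _).mpr h
  rw [map_mul, Polynomial.aeval_C]
  simp

theorem HasLead.pow_dvd_aeval_sub {e : ℕ} {c : ℤ} {p : Polynomial ℤ} (h : HasLead e c p)
    (y : ℤ⟦X⟧) :
    (3 : ℤ⟦X⟧) ^ (e + 3) ∣ Polynomial.aeval y p - C (p.coeff 0) := by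
  have := pow_dvd_aeval_of_coeff (e := e + 3) (p := p - Polynomial.C (p.coeff 0)) y fun j => by
    obtain _ | j := j
    · simp
    · rw [Polynomial.coeff_sub, Polynomial.coeff_C_succ, sub_zero]
      exact (pow_dvd_pow _ (by omega)).trans (h.1 (j + 1))
  rw [map_sub, Polynomial.aeval_C] at this
  simpa using this

/-- E³h = X E(X³)¹² E⁻⁹, to which `eulerInv_pow_nine` applies. Only class 1 meets the term X free of
a factor 9. -/
theorem euler_cube_mul_hauptmodul : euler ^ 3 * cubeVar eulerInv ^ 6 * hauptmodul
    = cubeVar (cubeVar euler ^ 3 * eulerInv ^ 6)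
      * (X + 9 * (X * cubeQuot) + 27 * (X * cubeQuot ^ 2)) := by
  have h3 := pow_mul_pow_eq_one 3 euler_mul_eulerInv
  have h6 := pow_mul_pow_eq_one 6 cubeVar_euler_mul_eulerInv
  have h := eulerInv_pow_nine
  simp only [map_mul, map_pow] at *
  generalize cubeQuot = w at *
  rw [hauptmodul]
  linear_combination (exp := 1) X * cubeVar eulerInv ^ 6 * cubeVar euler ^ 12 * eulerInv ^ 9 * h3
    + X * cubeVar euler ^ 6 * eulerInv ^ 9 * h6 + X * cubeVar euler ^ 6 * h
    + X * cubeVar (cubeVar euler) ^ 3 * cubeVar eulerInv ^ 6 * (1 + 9 * w + 27 * w ^ 2) * h6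

theorem nine_dvd_coeff_euler_cube_mul_hauptmodul (n : ℕ) :
    (3 : ℤ) ^ 2 ∣ coeff (3 * n + 2) (euler ^ 3 * cubeVar eulerInv ^ 6 * hauptmodul) := by
  have e : euler ^ 3 * cubeVar eulerInv ^ 6 * hauptmodul
      = X * cubeVar (cubeVar euler ^ 3 * eulerInv ^ 6) + 3 ^ 2 *
        (cubeVar (cubeVar euler ^ 3 * eulerInv ^ 6) * (X * cubeQuot + 3 * (X * cubeQuot ^ 2))) := by
    rw [euler_cube_mul_hauptmodul]; ring
  rw [e, map_add, show 3 * n + 2 = 3 * n + 1 + 1 by ring, coeff_succ_X_mul,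
    coeff_expand_of_not_dvd _ _ _ (by omega), zero_add]
  exact pow_dvd_coeff (dvd_mul_right _ _) _

/-- Class 2 of w carries the coefficient 3 in its dissection; this is the third power of 3 needed
for part (3). -/
theorem sect_X_mul_cubeQuot : (3 : ℤ⟦X⟧) ∣ sect (X * cubeQuot) := by
  have e : cubeVar (euler ^ 12) * (X * cubeQuot)
      = X ^ 2 * cubeVar (cubeVar euler ^ 6 * eulerCubeSect ^ 2)
        + cubeVar (X * (3 * eulerCubeSect * cubeVar euler ^ 9))
        + X * cubeVar (9 * X * cubeVar euler ^ 12) := by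
    rw [mul_left_comm, cubeQuot_mul_cubeVar, map_mul cubeVar X, cubeVar_X]; ring
  have h := congrArg sect e
  rw [map_add, map_add, sect_X_mul_cubeVar, sect_X_sq_mul_cubeVar, sect_cubeVar,
    sect_cubeVar_mul] at h
  have h12 := pow_mul_pow_eq_one 12 euler_mul_eulerInv
  exact ⟨eulerInv ^ 12 * X * eulerCubeSect * cubeVar euler ^ 9, by
    linear_combination eulerInv ^ 12 * h - sect (X * cubeQuot) * h12⟩

theorem coeff_three_mul_euler_cube_mul_hauptmodul (n : ℕ) :
    (3 : ℤ) ^ 3 ∣ coeff (3 * n) (euler ^ 3 * cubeVar eulerInv ^ 6 * hauptmodul) := by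
  rw [← coeff_sect, euler_cube_mul_hauptmodul, sect_cubeVar_mul]
  apply pow_dvd_coeff
  have hX : sect X = 0 := by simpa using sect_X_mul_cubeVar 1
  rw [map_add, map_add, hX, zero_add]
  have h9 := sect_ofNat_mul 9 (X * cubeQuot)
  have h27 := sect_ofNat_mul 27 (X * cubeQuot ^ 2)
  push_cast at h9 h27
  rw [h9, h27]
  obtain ⟨g, hg⟩ := sect_X_mul_cubeQuot
  exact ⟨cubeVar euler ^ 3 * eulerInv ^ 6 * (g + sect (X * cubeQuot ^ 2)), by rw [hg]; ring⟩

/-- Frobenius gives E(X³) ≡ E³ modulo 3, and cubing improves this to modulo 9. -/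
theorem nine_dvd_sub_euler_cube :
    (3 : ℤ⟦X⟧) ^ 2 ∣ eulerInv ^ 6 * cubeVar euler ^ 3 - euler ^ 3 := by
  obtain ⟨g, hg⟩ := three_dvd_cubeVar_sub_pow euler
  have h : cubeVar euler = euler ^ 3 + 3 * g := by linear_combination hg
  have h6 := pow_mul_pow_eq_one 6 euler_mul_eulerInv
  exact ⟨eulerInv ^ 6 * (euler ^ 6 * g + 3 * euler ^ 3 * g ^ 2 + 3 * g ^ 3), by
    rw [h]; linear_combination euler ^ 3 * h6⟩

theorem HasLead.pow_dvd_coeff_sub {e : ℕ} {c : ℤ} {p : Polynomial ℤ} (h : HasLead e c p) (n : ℕ) :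
    (3 : ℤ) ^ (e + 2) ∣ coeff n (eulerInv ^ 6 * cubeVar euler ^ 3 * Polynomial.aeval hauptmodul p)
      - c * coeff n (euler ^ 3) := by
  rw [← coeff_C_mul, ← map_sub]
  apply pow_dvd_coeff
  have h1 := (pow_dvd_pow (3 : ℤ⟦X⟧) (show e + 2 ≤ e + 3 by omega)).trans
    (h.pow_dvd_aeval_sub hauptmodul)
  have h2 : (3 : ℤ⟦X⟧) ^ (e + 2) ∣ C (p.coeff 0) - C c := by
    rw [← map_sub, show (3 : ℤ⟦X⟧) ^ (e + 2) = C (3 ^ (e + 2)) by simp]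
    exact map_dvd C h.2
  have h3 : (3 : ℤ⟦X⟧) ^ e ∣ C (p.coeff 0) := by
    rw [show (3 : ℤ⟦X⟧) ^ e = C (3 ^ e) by simp]
    exact map_dvd C (by simpa using h.1 0)
  have h4 := mul_dvd_mul h3 nine_dvd_sub_euler_cube
  rw [← pow_add] at h4
  have e1 : eulerInv ^ 6 * cubeVar euler ^ 3 * Polynomial.aeval hauptmodul p - C c * euler ^ 3
      = eulerInv ^ 6 * cubeVar euler ^ 3 * (Polynomial.aeval hauptmodul p - C (p.coeff 0))
        + C (p.coeff 0) * (eulerInv ^ 6 * cubeVar euler ^ 3 - euler ^ 3)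
        + euler ^ 3 * (C (p.coeff 0) - C c) := by ring
  rw [e1]
  exact dvd_add (dvd_add (h1.mul_left _) h4) (h2.mul_left _)

theorem HasLead.coeff_dvd_of_dvd {e d : ℕ} (hd : d ≤ 3) {c : ℤ} {p : Polynomial ℤ}
    (h : HasLead e c p) {n : ℕ}
    (hn : (3 : ℤ) ^ d ∣ coeff n (euler ^ 3 * cubeVar eulerInv ^ 6 * hauptmodul)) :
    (3 : ℤ) ^ (e + d) ∣ coeff n (euler ^ 3 * cubeVar eulerInv ^ 6 *
      (hauptmodul * Polynomial.aeval hauptmodul p)) := by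
  have e1 : euler ^ 3 * cubeVar eulerInv ^ 6 * (hauptmodul * Polynomial.aeval hauptmodul p)
      = C (p.coeff 0) * (euler ^ 3 * cubeVar eulerInv ^ 6 * hauptmodul)
        + euler ^ 3 * cubeVar eulerInv ^ 6 * hauptmodul
          * (Polynomial.aeval hauptmodul p - C (p.coeff 0)) := by ring
  rw [e1, map_add, coeff_C_mul]
  refine dvd_add ?_ (pow_dvd_coeff (((pow_dvd_pow _ (by omega)).trans
    (h.pow_dvd_aeval_sub hauptmodul)).mul_left _) _)
  rw [pow_add]
  exact mul_dvd_mul (by simpa using h.1 0) hn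

/-! ### Matching indices, and the theorem. -/

theorem expand_eq_cubeVar_expand {m m' : ℕ} (h : m' = 3 * m) (hm : m ≠ 0) (hm' : m' ≠ 0)
    (f : ℤ⟦X⟧) : expand m' hm' f = cubeVar (expand m hm f) := by
  subst h
  exact expand_mul 3 three_ne_zero m hm f

theorem iterate_sect_expand_mul (α : ℕ) (g f : ℤ⟦X⟧) :
    (fun f => sect (X * sect f))^[α] (expand (3 ^ (2 * α)) (by positivity) g * f)
      = g * (fun f => sect (X * sect f))^[α] f := by
  induction α generalizing f with
  | zero => simp
  | succ α ih =>
    rw [Function.iterate_succ_apply, Function.iterate_succ_apply, ← ih]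
    congr 1
    rw [expand_eq_cubeVar_expand (m := 3 ^ (2 * α + 1)) (by ring) (by positivity),
      sect_cubeVar_mul, expand_eq_cubeVar_expand (m := 3 ^ (2 * α)) (by ring) (by positivity),
      mul_left_comm, sect_cubeVar_mul]

/-- With coefficients numbered from m + 1, one round sends m to 9m+5, so 8m+5 is multiplied by 9. -/
theorem coeff_iterate_sect (α : ℕ) (f : ℤ⟦X⟧) {m N : ℕ} (h : 8 * N + 5 = 9 ^ α * (8 * m + 5)) :
    coeff (m + 1) ((fun f => sect (X * sect f))^[α] f) = coeff (N + 1) f := by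
  induction α generalizing m with
  | zero =>
    obtain rfl : N = m := by omega
    rfl
  | succ α ih =>
    rw [Function.iterate_succ_apply', coeff_sect, show 3 * (m + 1) = 3 * m + 2 + 1 by ring,
      coeff_succ_X_mul, coeff_sect, show 3 * (3 * m + 2) = 9 * m + 5 + 1 by ring]
    exact ih (by rw [h]; ring)

theorem coeff_iterate_sectOne (β : ℕ) (f : ℤ⟦X⟧) {m N : ℕ}
    (h : 8 * N + 3 = 9 ^ β * (8 * m + 3)) :
    coeff (m + 1) ((fun f => sect (X ^ 2 * sectOne f))^[β] f) = coeff (N + 1) f := by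
  induction β generalizing m with
  | zero =>
    obtain rfl : N = m := by omega
    rfl
  | succ β ih =>
    rw [Function.iterate_succ_apply', coeff_sect, show 3 * (m + 1) = 3 * m + 1 + 2 by ring,
      coeff_X_pow_mul, coeff_sectOne, show 3 * (3 * m + 1) + 1 = 9 * m + 3 + 1 by ring]
    exact ih (by rw [h]; ring)

theorem exists_nine_pow (a : ℕ) : ∃ t, 9 ^ a = 8 * t + 1 := by
  induction a with
  | zero => exact ⟨0, rfl⟩
  | succ a ih =>
    obtain ⟨t, ht⟩ := ih
    exact ⟨9 * t + 1, by rw [pow_succ, ht]; ring⟩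

/-- The coefficients of the iterated sections are values of `pmT`. -/
theorem coeff_iterate_eq_pmT (α β : ℕ) {n L : ℕ}
    (hL : 8 * L = 3 ^ (2 * α + 2 * β + 1) * (8 * n + 3) + 2 * 3 ^ (2 * α + 1) + 1) :
    coeff (n + 1) ((fun f => sect (X ^ 2 * sectOne f))^[β] (euler ^ 3 * cubeVar eulerInv ^ 3 *
      (fun f => sect (X * sect f))^[α] (sect (X * eulerInv ^ 3)))) = pmT (2 * α + 1) L := by
  obtain ⟨s, hs⟩ := exists_nine_pow α
  obtain ⟨t, ht⟩ := exists_nine_pow β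
  have hM : 8 * (t * (8 * n + 3) + n) + 3 = 9 ^ β * (8 * n + 3) := by rw [ht]; ring
  set M := t * (8 * n + 3) + n
  have hN : 8 * (s * (8 * M + 5) + M) + 5 = 9 ^ α * (8 * M + 5) := by rw [hs]; ring
  set N := s * (8 * M + 5) + M
  have hLN : L = 3 * N + 2 := by
    have e1 : 3 ^ (2 * α + 2 * β + 1) = 3 * 9 ^ α * 9 ^ β := by
      rw [pow_succ, pow_add, pow_mul, pow_mul]; norm_num; ring
    have e2 : 3 ^ (2 * α + 1) = 3 * 9 ^ α := by rw [pow_succ, pow_mul]; norm_num; ring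
    rw [e1, e2] at hL
    have : 3 * 9 ^ α * 9 ^ β * (8 * n + 3) = 3 * 9 ^ α * (8 * M + 3) := by rw [hM]; ring
    rw [this] at hL
    have : 8 * L = 8 * (3 * N + 2) := by
      have e3 : 8 * (3 * N + 2) = 3 * (8 * N + 5) + 1 := by ring
      rw [hL, e3, hN]; ring
    omega
  -- After undoing the β-rounds, the factor E³/E(X³)³ moves back through the α-rounds and the first
  -- trisection, becoming its expansion by 3 ^ (2α+1).
  rw [coeff_iterate_sectOne β _ hM, ← iterate_sect_expand_mul, coeff_iterate_sect α _ hN,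
    ← sect_cubeVar_mul, ← expand_eq_cubeVar_expand (m' := 3 ^ (2 * α + 1)) (by ring) (by positivity)
      (by positivity), coeff_sect, mul_left_comm, show 3 * (N + 1) = 3 * N + 2 + 1 by ring,
    coeff_succ_X_mul, mul_comm (expand _ _ _), ← mk_pmT, coeff_mk, hLN]

/-- For triangular m, 8m+1 is a square, whereas p occurs on the right with the odd exponent 2k+1. -/
theorem not_triangle {p k n m : ℕ} (hp : p.Prime) (hp2 : p ≠ 2) (hn : ¬ p ∣ n)
    (hm : 8 * m + 1 = p ^ (2 * k + 1) * (8 * n + p)) : ¬ ∃ j : ℕ, m = j * (j + 1) / 2 := by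
  rintro ⟨j, rfl⟩
  have h1 : p ^ (2 * k + 1) * (8 * n + p) = (2 * j + 1) ^ 2 := by
    have := two_mul_triangle j
    rw [← hm]; nlinarith
  have h2 : ¬ p ∣ 8 * n + p := by
    rw [Nat.dvd_add_self_right, hp.dvd_mul]
    rintro (h | h)
    · exact hp2 ((Nat.prime_dvd_prime_iff_eq hp Nat.prime_two).mp
        (hp.dvd_of_dvd_pow (show p ∣ 2 ^ 3 from h)))
    · exact hn h
  have h3 := congrArg (fun x => x.factorization p) h1
  have h4 : 8 * n + p ≠ 0 := by have := hp.pos; omega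
  simp only [Nat.factorization_mul (pow_ne_zero _ hp.ne_zero) h4, Nat.factorization_pow,
    Finsupp.add_apply, Finsupp.smul_apply, hp.factorization_self, smul_eq_mul, mul_one,
    Nat.factorization_eq_zero_of_not_dvd h2] at h3
  omega

theorem eight_mul_index {A c n : ℕ} (h : 8 ∣ c) : 8 * (A * n + c / 8) = A * (8 * n) + c := by
  rw [mul_add, Nat.mul_div_cancel' h]; ring

theorem eight_dvd_index (α β : ℕ) {c : ℕ} (hc : c % 8 = 3) :
    8 ∣ c * 3 ^ (2 * α + 2 * β + 1) + 2 * 3 ^ (2 * α + 1) + 1 := by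
  obtain ⟨s, hs⟩ := exists_nine_pow α
  obtain ⟨t, ht⟩ := exists_nine_pow (α + β)
  have e1 : 3 ^ (2 * α + 2 * β + 1) = 3 * 9 ^ (α + β) := by
    rw [← mul_add, pow_succ, pow_mul]; norm_num; ring
  have e2 : 3 ^ (2 * α + 1) = 3 * 9 ^ α := by rw [pow_succ, pow_mul]; norm_num; ring
  rw [e1, e2, hs, ht]
  obtain ⟨d, rfl⟩ : ∃ d, c = 8 * d + 3 := ⟨c / 8, by omega⟩
  exact ⟨(8 * d + 3) * 3 * t + 3 * d + 6 * s + 2, by ring⟩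

theorem theorem1p3 (α β n : ℕ) :
    pmT (2 * α + 1) (3 ^ (2 * α + 2 * β + 1) * n
        + (3 ^ (2 * α + 2 * β + 2) + 2 * 3 ^ (2 * α + 1) + 1) / 8)
      ≡ 0 [MOD 3 ^ (3 * α + β + 2)] ∧
    pmT (2 * α + 1) (3 ^ (2 * α + 2 * β + 2) * n
        + (11 * 3 ^ (2 * α + 2 * β + 1) + 2 * 3 ^ (2 * α + 1) + 1) / 8)
      ≡ 0 [MOD 3 ^ (3 * α + β + 4)] ∧
    pmT (2 * α + 1) (3 ^ (2 * α + 2 * β + 2) * n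
        + (19 * 3 ^ (2 * α + 2 * β + 1) + 2 * 3 ^ (2 * α + 1) + 1) / 8)
      ≡ 0 [MOD 3 ^ (3 * α + β + 5)] ∧
    (∀ j : ℕ, n = j * (j + 1) / 2 →
      (pmT (2 * α + 1) (3 ^ (2 * α + 2 * β + 2) * n
          + (3 ^ (2 * α + 2 * β + 2) + 2 * 3 ^ (2 * α + 1) + 1) / 8) : ℤ)
        ≡ 2 ^ β * 5 ^ α * 3 ^ (3 * α + β + 2) * ((-1) ^ j * (2 * (j : ℤ) + 1))
          [ZMOD 3 ^ (3 * α + β + 4)]) ∧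
    ((¬ ∃ j : ℕ, n = j * (j + 1) / 2) →
      pmT (2 * α + 1) (3 ^ (2 * α + 2 * β + 2) * n
          + (3 ^ (2 * α + 2 * β + 2) + 2 * 3 ^ (2 * α + 1) + 1) / 8)
        ≡ 0 [MOD 3 ^ (3 * α + β + 4)]) ∧
    (∀ p k : ℕ, p.Prime → p ≠ 2 → ¬ p ∣ n →
      pmT (2 * α + 1) (3 ^ (2 * α + 2 * β + 2) * p ^ (2 * k + 1) * n
          + (p ^ (2 * k + 2) * 3 ^ (2 * α + 2 * β + 2) + 2 * 3 ^ (2 * α + 1) + 1) / 8)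
        ≡ 0 [MOD 3 ^ (3 * α + β + 4)]) := by
  obtain ⟨p, h1, h2⟩ := exists_iterate_sectOne α β
  obtain ⟨q, h3, h4⟩ := exists_sectOne_hasLead h2
  have hT := fun {n L : ℕ} => coeff_iterate_eq_pmT α β (n := n) (L := L)
  rw [h1] at hT
  have hpow : 3 ^ (2 * α + 2 * β + 2) = 3 * 3 ^ (2 * α + 2 * β + 1) := by ring
  have hmod : ∀ {L d : ℕ}, (3 : ℤ) ^ d ∣ (pmT (2 * α + 1) L : ℤ) →
      pmT (2 * α + 1) L ≡ 0 [MOD 3 ^ d] := fun {L d} h => by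
    rw [Nat.modEq_zero_iff_dvd, ← Int.natCast_dvd_natCast]
    push_cast
    exact h
  -- Since 3(8m+1) = 8·3m + 3, the coefficient index is 3m+1, the class kept by `sectOne`.
  have hsq : ∀ {m L : ℕ}, 8 * L = 3 ^ (2 * α + 2 * β + 2) * (8 * m + 1) + 2 * 3 ^ (2 * α + 1) + 1 →
      (3 : ℤ) ^ (3 * α + β + 4) ∣ (pmT (2 * α + 1) L : ℤ)
        - 2 ^ β * 5 ^ α * 3 ^ (3 * α + β + 2) * coeff m (euler ^ 3) := fun {m L} h => by
    have h5 := h4.pow_dvd_coeff_sub m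
    rwa [← h3, coeff_sectOne, hT (L := L) (by rw [h, hpow]; ring)] at h5
  have h8 := eight_dvd_index α β (c := 3) rfl
  rw [← hpow] at h8
  have hidx : 8 * (3 ^ (2 * α + 2 * β + 2) * n
      + (3 ^ (2 * α + 2 * β + 2) + 2 * 3 ^ (2 * α + 1) + 1) / 8)
      = 3 ^ (2 * α + 2 * β + 2) * (8 * n + 1) + 2 * 3 ^ (2 * α + 1) + 1 := by
    rw [eight_mul_index h8]; ring
  refine ⟨hmod ?_, hmod ?_, hmod ?_, fun j hj => ?_, fun hj => hmod ?_, fun r k hr hr2 hrn => hmod ?_⟩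
  · rw [← hT (n := n) (by rw [eight_mul_index h8, hpow]; ring)]
    exact h2.coeff_dvd_of_dvd (d := 0) (by norm_num) (by simp)
  -- 8(3n+1) + 3 = 24n + 11, at coefficient index 3n+2; likewise 19 below comes from 3n+2, at index
  -- 3(n+1).
  · rw [← hT (n := 3 * n + 1)
      (by rw [eight_mul_index (eight_dvd_index α β (by norm_num)), hpow]; ring)]
    exact h2.coeff_dvd_of_dvd (d := 2) (by norm_num)
      (nine_dvd_coeff_euler_cube_mul_hauptmodul n)
  · rw [← hT (n := 3 * n + 2)
      (by rw [eight_mul_index (eight_dvd_index α β (by norm_num)), hpow]; ring)]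
    exact h2.coeff_dvd_of_dvd (d := 3) (by norm_num)
      (coeff_three_mul_euler_cube_mul_hauptmodul (n + 1))
  · have h5 := hsq hidx
    rw [hj, coeff_euler_cube_triangle, ← hj] at h5
    exact (Int.modEq_iff_dvd.mpr h5).symm
  · have h5 := hsq hidx
    rwa [coeff_euler_cube_eq_zero hj, mul_zero, sub_zero] at h5
  -- An odd square is 8t+1, so part (5) is the case m = r ^ (2k+1) * n + t of `hsq`.
  · obtain ⟨t, ht⟩ : ∃ t, r ^ (2 * k + 2) = 8 * t + 1 := by
      have hodd : (r ^ (k + 1)) % 2 = 1 :=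
        Nat.odd_iff.mp (Odd.pow (hr.odd_of_ne_two hr2))
      obtain ⟨u, hu⟩ : ∃ u, r ^ (k + 1) = 2 * u + 1 := ⟨r ^ (k + 1) / 2, by omega⟩
      refine ⟨u * (u + 1) / 2, ?_⟩
      have := two_mul_triangle u
      rw [show 2 * k + 2 = (k + 1) * 2 by ring, pow_mul, hu]
      nlinarith
    have hm : 8 * (r ^ (2 * k + 1) * n + t) + 1 = r ^ (2 * k + 1) * (8 * n + r) := by
      have : r ^ (2 * k + 1) * (8 * n + r) = 8 * (r ^ (2 * k + 1) * n) + r ^ (2 * k + 2) := by ring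
      rw [this, ht]; ring
    have h9 : 8 ∣ r ^ (2 * k + 2) * 3 ^ (2 * α + 2 * β + 2) + 2 * 3 ^ (2 * α + 1) + 1 := by
      have := eight_dvd_index α β (c := 3 * (8 * t + 1)) (by omega)
      rw [ht, hpow]
      convert this using 1
      ring
    have h5 := hsq (m := r ^ (2 * k + 1) * n + t)
      (L := 3 ^ (2 * α + 2 * β + 2) * r ^ (2 * k + 1) * n
          + (r ^ (2 * k + 2) * 3 ^ (2 * α + 2 * β + 2) + 2 * 3 ^ (2 * α + 1) + 1) / 8)
      (by rw [eight_mul_index h9, hm]; ring)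
    rwa [coeff_euler_cube_eq_zero (not_triangle hr hr2 hrn hm), mul_zero, sub_zero] at h5
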